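/- Let $(M,g)$ be a connected Lorentzian manifold of dimension $n\ge 3$ (smooth, $g$ of signature $(-,+,\dots,+)$) with Levi-Civita connection $\nabla$, and let $K$ be a smooth timelike vector field on $M$, i.e. $g(K_p,K_p)<0$ for all $p\in M$. Let $\pi:TM\to M$ be the projection, let $c:TTM\to TM$ be the connector of $\nabla$ (so that $c(\alpha'(0))=\frac{\nabla\alpha}{dt}\big|_0$ for a curve $\alpha$ in $TM$, regarded as a vector field along $\pi\circ\alpha$), and let $\widehat g(\zeta,\xi)=g(d\pi\,\zeta,d\pi\,\xi)+g(c(\zeta),c(\xi))$ be the Sasaki metric on $TM$. Let $$C_KM=\{v\in TM:\ g(v,v)=0,\ g(v,K_{\pi(v)})=-1\}$$ be the null congruence of $K$. Then $C_KM$ is an embedded submanifold of $TM$ of dimension $2(n-1)$. Equip it with this smooth structure and with the metric induced by $\widehat g$, again denoted $\widehat g$, with Levi-Civita connection $\widehat\nabla$. For $v\in C_KM$ let $\mathcal V_v=\ker d(\pi|_{C_KM})_v$ be the vertical space and $\mathcal H_v$ its $\widehat g$-orthogonal complement in $T_vC_KM$, the horizontal space; $\mathcal V$ and $\mathcal H$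 also denote the orthogonal projections onto them. Let $T$ be the O'Neill tensor of $\pi|_{C_KM}$, $$T_{E_1}E_2=\mathcal H\widehat\nabla_{\mathcal VE_1}\mathcal VE_2+\mathcal V\widehat\nabla_{\mathcal VE_1}\mathcal HE_2 ,$$ for vector fields $E_1,E_2$ on $C_KM$; for tangent vectors $\xi,\zeta\in T_vC_KM$, $T_\xi\zeta$ is the value at $v$ of $T_{E_1}E_2$ for any smooth vector fields $E_1,E_2$ with $E_1(v)=\xi$, $E_2(v)=\zeta$. Then for every $v\in C_KM$, all vertical $\xi,\zeta\in\mathcal V_v$ and every horizontal $\mathcal Z\in\mathcal H_v$, $$\widehat g(T_\xi\zeta,\mathcal Z)=-\,g\big(v,\nabla_{\mathcal Z_\star}K\big)\,\widehat g(\xi,\zeta),\qquad \mathcal Z_\star=d\pi(\mathcal Z),$$ whatever the extensions $E_1,E_2$ of $\xi,\zeta$ used to compute $T_\xi\zeta$. -/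

import Mathlib

open Manifold
open scoped ContDiff

noncomputable section

namespace NullCongruence

/-- `ℝᵐ`, the model space of `m`-dimensional manifolds. -/
abbrev Eu (m : ℕ) : Type := EuclideanSpace ℝ (Fin m)

/-- The bilinear form `(u, w) ↦ B (A u, A w)`, for `A` linear and `B` bilinear. -/
def pullbackForm {V W : Type*} [AddCommGroup V] [Module ℝ V] [TopologicalSpace V]
    [IsTopologicalAddGroup V] [ContinuousSMul ℝ V] [AddCommGroup W] [Module ℝ W]
    [TopologicalSpace W] [IsTopologicalAddGroup W] [ContinuousSMul ℝ W]
    (A : V →L[ℝ] W) (B : W →L[ℝ] W →L[ℝ] ℝ) : V →L[ℝ] V →L[ℝ] ℝ :=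
  (ContinuousLinearMap.precomp ℝ A).comp (B.comp A)

/-! ### The Levi-Civita connection -/

section VectorSpace

variable {V : Type*} [NormedAddCommGroup V] [NormedSpace ℝ V]

set_option maxSynthPendingDepth 3 in
/-- The Christoffel symbols of the first kind, at `y`, of a metric `G` on an open set of a vector
space, as the trilinear form
`(u, w, z) ↦ ½ ((∂_u G)(w, z) + (∂_w G)(u, z) - (∂_z G)(u, w))`. -/
def christoffelFirst (G : V → (V →L[ℝ] V →L[ℝ] ℝ)) (y : V) : V →L[ℝ] V →L[ℝ] (V →L[ℝ] ℝ) :=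
  let D : V →L[ℝ] V →L[ℝ] (V →L[ℝ] ℝ) := fderiv ℝ G y
  let D' : V →L[ℝ] V →L[ℝ] (V →L[ℝ] ℝ) := D.flip
  let D'' : V →L[ℝ] V →L[ℝ] (V →L[ℝ] ℝ) :=
    ((ContinuousLinearMap.flipₗᵢ ℝ V V ℝ).toContinuousLinearEquiv.toContinuousLinearMap).comp D'
  (1 / 2 : ℝ) • (D + D' - D'')

set_option maxSynthPendingDepth 3 in
theorem christoffelFirst_apply (G : V → (V →L[ℝ] V →L[ℝ] ℝ)) (y u w z : V) :
    christoffelFirst G y u w z =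
      1 / 2 * (fderiv ℝ G y u w z + fderiv ℝ G y w u z - fderiv ℝ G y z u w) := by
  simp [christoffelFirst]

/-- The Christoffel symbols (of the second kind) at `y` of a metric `G` on an open set of a vector
space, as a bilinear map: for nondegenerate `G y`, `christoffel G y u w` is the vector `Γ` such that
`G y Γ z = christoffelFirst G y u w z` for all `z`. -/
def christoffel (G : V → (V →L[ℝ] V →L[ℝ] ℝ)) (y : V) : V →L[ℝ] V →L[ℝ] V :=
  (ContinuousLinearMap.compL ℝ V (V →L[ℝ] ℝ) V (ContinuousLinearMap.inverse (G y))).comp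
    (christoffelFirst G y)

theorem christoffel_spec (G : V → (V →L[ℝ] V →L[ℝ] ℝ)) (y u w z : V)
    (hG : (G y).IsInvertible) :
    G y (christoffel G y u w) z = christoffelFirst G y u w z := by
  have h := hG.self_comp_inverse
  simpa [christoffel] using
    congrArg (fun f : V →L[ℝ] ℝ => f z) (DFunLike.congr_fun h (christoffelFirst G y u w))

end VectorSpace

section Manifold

variable {m : ℕ} {N : Type*} [TopologicalSpace N] [ChartedSpace (Eu m) N]

/-- The differential at `q` of the chart of `N` at `p`. -/
def chartDeriv (p q : N) : TangentSpace (𝓡 m) q →L[ℝ] Eu m :=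
  mfderiv (𝓡 m) 𝓘(ℝ, Eu m) (extChartAt (𝓡 m) p) q

/-- The differential at `y` of the inverse of the chart of `N` at `p`. -/
def chartSymmDeriv (p : N) (y : Eu m) :
    Eu m →L[ℝ] TangentSpace (𝓡 m) ((extChartAt (𝓡 m) p).symm y) :=
  mfderiv 𝓘(ℝ, Eu m) (𝓡 m) (extChartAt (𝓡 m) p).symm y

/-- The metric `h` of the manifold `N`, read in the chart of `N` at `p`. -/
def metricInChart (h : Π q : N, TangentSpace (𝓡 m) q →L[ℝ] TangentSpace (𝓡 m) q →L[ℝ] ℝ)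
    (p : N) : Eu m → (Eu m →L[ℝ] Eu m →L[ℝ] ℝ) := fun y =>
  pullbackForm (chartSymmDeriv p y) (h ((extChartAt (𝓡 m) p).symm y))

/-- The vector field `Y` on the manifold `N`, read in the chart of `N` at `p`. -/
def fieldInChart (Y : Π q : N, TangentSpace (𝓡 m) q) (p : N) : Eu m → Eu m := fun y =>
  chartDeriv p ((extChartAt (𝓡 m) p).symm y) (Y ((extChartAt (𝓡 m) p).symm y))

/-- `leviCivita h Y p z` is the covariant derivative `∇_z Y` at `p`, where `∇` is the Levi-Civita
connection of the (possibly indefinite) metric `h`. In the chart at `p` it is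
`∂_z Y + Γ(z, Y)`. -/
def leviCivita (h : Π q : N, TangentSpace (𝓡 m) q →L[ℝ] TangentSpace (𝓡 m) q →L[ℝ] ℝ)
    (Y : Π q : N, TangentSpace (𝓡 m) q) (p : N) (z : TangentSpace (𝓡 m) p) :
    TangentSpace (𝓡 m) p :=
  let y₀ : Eu m := extChartAt (𝓡 m) p p
  let z' : Eu m := chartDeriv p p z
  (chartDeriv p p).inverse
    (fderiv ℝ (fieldInChart Y p) y₀ z' +
      christoffel (metricInChart h p) y₀ z' (fieldInChart Y p y₀))

/-- The connector `c : T_v(TN) → T_pN`, `p = π(v)`, of the Levi-Civita connection of `h`: the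
covariant derivative at time `0` of any curve `α` in `TN`, viewed as a vector field along `π ∘ α`,
with velocity `α'(0) = ξ`. If, in the chart of `TN` induced by the chart of `N` at `p`, the curve
is `t ↦ (x(t), a(t))`, so that `ξ = (x'(0), a'(0))`, this is `a'(0) + Γ(x'(0), a(0))`. -/
def connector [IsManifold (𝓡 m) ∞ N]
    (h : Π q : N, TangentSpace (𝓡 m) q →L[ℝ] TangentSpace (𝓡 m) q →L[ℝ] ℝ)
    (v : TangentBundle (𝓡 m) N) :
    TangentSpace (𝓡 m).tangent v →L[ℝ] TangentSpace (𝓡 m) v.proj :=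
  let y₀ : Eu m := extChartAt (𝓡 m) v.proj v.proj
  let a : Eu m := chartDeriv v.proj v.proj v.2
  let D : TangentSpace (𝓡 m).tangent v →L[ℝ] Eu m × Eu m :=
    mfderiv (𝓡 m).tangent 𝓘(ℝ, Eu m × Eu m) (extChartAt (𝓡 m).tangent v) v
  (chartDeriv v.proj v.proj).inverse.comp
    ((ContinuousLinearMap.snd ℝ (Eu m) (Eu m) +
      ((christoffel (metricInChart h v.proj) y₀).flip a).comp
        (ContinuousLinearMap.fst ℝ (Eu m) (Eu m))).comp D)

/-- The Sasaki metric `ĝ(ζ, ξ) = g(dπ ζ, dπ ξ) + g(c(ζ), c(ξ))` on `TN` of the metric `h = g`. -/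
def sasaki [IsManifold (𝓡 m) ∞ N]
    (h : Π q : N, TangentSpace (𝓡 m) q →L[ℝ] TangentSpace (𝓡 m) q →L[ℝ] ℝ)
    (v : TangentBundle (𝓡 m) N) :
    TangentSpace (𝓡 m).tangent v →L[ℝ] TangentSpace (𝓡 m).tangent v →L[ℝ] ℝ :=
  pullbackForm (mfderiv (𝓡 m).tangent (𝓡 m) (fun x : TangentBundle (𝓡 m) N => x.proj) v)
      (h v.proj) +
    pullbackForm (connector h v) (h v.proj)

/-! ### Submersions and the O'Neill tensor `T` -/

variable {n : ℕ} {M : Type*} [TopologicalSpace M] [ChartedSpace (Eu n) M]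

/-- The vertical space at `q` of a submersion `pr`. -/
def vertical (pr : N → M) (q : N) : Submodule ℝ (TangentSpace (𝓡 m) q) :=
  LinearMap.ker (mfderiv (𝓡 m) (𝓡 n) pr q : TangentSpace (𝓡 m) q →ₗ[ℝ] TangentSpace (𝓡 n) (pr q))

/-- The horizontal space at `q`: the vectors orthogonal, for the metric `h`, to all vertical ones. -/
def horizontal (h : Π q : N, TangentSpace (𝓡 m) q →L[ℝ] TangentSpace (𝓡 m) q →L[ℝ] ℝ)
    (pr : N → M) (q : N) : Submodule ℝ (TangentSpace (𝓡 m) q) where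
  carrier := {e | ∀ u ∈ vertical (m := m) (n := n) pr q, h q u e = 0}
  add_mem' ha hb u hu := by simp [ha u hu, hb u hu]
  zero_mem' u _ := by simp
  smul_mem' c a ha u hu := by simp [ha u hu]

open Classical in
/-- The orthogonal projection `𝒱` onto the vertical space at `q` (with value `0` if the tangent
space is not the direct sum of the vertical and the horizontal space). -/
def vertProj (h : Π q : N, TangentSpace (𝓡 m) q →L[ℝ] TangentSpace (𝓡 m) q →L[ℝ] ℝ)
    (pr : N → M) (q : N) (e : TangentSpace (𝓡 m) q) : TangentSpace (𝓡 m) q :=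
  if hc : IsCompl (vertical (m := m) (n := n) pr q) (horizontal (n := n) h pr q) then
    Submodule.projection _ _ hc e
  else 0

open Classical in
/-- The orthogonal projection `ℋ` onto the horizontal space at `q` (with value `0` if the tangent
space is not the direct sum of the vertical and the horizontal space). -/
def horProj (h : Π q : N, TangentSpace (𝓡 m) q →L[ℝ] TangentSpace (𝓡 m) q →L[ℝ] ℝ)
    (pr : N → M) (q : N) (e : TangentSpace (𝓡 m) q) : TangentSpace (𝓡 m) q :=
  if hc : IsCompl (vertical (m := m) (n := n) pr q) (horizontal (n := n) h pr q) then
    Submodule.projection _ _ hc.symm e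
  else 0

/-- O'Neill's fundamental tensor `T` of the submersion `pr : (N, h) → M`, on vector fields:
`T_{E₁} E₂ = ℋ ∇_{𝒱 E₁} (𝒱 E₂) + 𝒱 ∇_{𝒱 E₁} (ℋ E₂)`. -/
def oneillT (h : Π q : N, TangentSpace (𝓡 m) q →L[ℝ] TangentSpace (𝓡 m) q →L[ℝ] ℝ)
    (pr : N → M) (E₁ E₂ : Π q : N, TangentSpace (𝓡 m) q) (q : N) : TangentSpace (𝓡 m) q :=
  horProj (n := n) h pr q
      (leviCivita h (fun x => vertProj (n := n) h pr x (E₂ x)) q (vertProj (n := n) h pr q (E₁ q))) +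
    vertProj (n := n) h pr q
      (leviCivita h (fun x => horProj (n := n) h pr x (E₂ x)) q (vertProj (n := n) h pr q (E₁ q)))

/-- The vector field `E` on `N` is smooth at `q`, with value `e` there. -/
def IsSmoothExtension [IsManifold (𝓡 m) ∞ N] (q : N) (e : TangentSpace (𝓡 m) q)
    (E : Π x : N, TangentSpace (𝓡 m) x) : Prop :=
  ContMDiffAt (𝓡 m) (𝓡 m).tangent ∞ (fun x => (⟨x, E x⟩ : TangentBundle (𝓡 m) N)) q ∧ E q = e

end Manifold

/-! ### Lorentzian manifolds and null congruences -/

/-- A (smooth) Lorentzian metric, of signature `(-, +, …, +)`, on an `n`-dimensional manifold. -/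
structure LorentzianMetric (n : ℕ) (M : Type*) [TopologicalSpace M] [ChartedSpace (Eu n) M]
    [IsManifold (𝓡 n) ∞ M] where
  /-- The scalar product `g_p` on the tangent space at `p`. -/
  val : Π p : M, TangentSpace (𝓡 n) p →L[ℝ] TangentSpace (𝓡 n) p →L[ℝ] ℝ
  symm : ∀ (p : M) (u w : TangentSpace (𝓡 n) p), val p u w = val p w u
  signature : ∀ p : M, ∃ b : Module.Basis (Fin n) ℝ (TangentSpace (𝓡 n) p), ∀ i j : Fin n,
    val p (b i) (b j) = if i = j then (if i.val = 0 then -1 else 1) else 0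
  contMDiff : ContMDiff (𝓡 n) ((𝓡 n).prod 𝓘(ℝ, Eu n →L[ℝ] Eu n →L[ℝ] ℝ)) ∞
    (fun p => Bundle.TotalSpace.mk' (Eu n →L[ℝ] Eu n →L[ℝ] ℝ)
      (E := fun p : M => TangentSpace (𝓡 n) p →L[ℝ] TangentSpace (𝓡 n) p →L[ℝ] ℝ) p (val p))

section Congruence

variable {n : ℕ} {M : Type*} [TopologicalSpace M] [ChartedSpace (Eu n) M] [IsManifold (𝓡 n) ∞ M]

/-- The null congruence `C_K M = {v ∈ TM | g(v, v) = 0, g(v, K_{π(v)}) = -1}`, with the topology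
induced from `TM`. -/
def nullCongruence (g : LorentzianMetric n M) (K : Π p : M, TangentSpace (𝓡 n) p) :
    Set (TangentBundle (𝓡 n) M) :=
  {v | g.val v.proj v.2 v.2 = 0 ∧ g.val v.proj v.2 (K v.proj) = -1}

/-- The given smooth structure on a subset `S` of `TM` (inducing the subspace topology of `S`) makes
`S` an embedded submanifold of `TM`: the inclusion `S → TM` is smooth with injective differentials.
-/
def IsEmbeddedSubmanifold (d : ℕ) (S : Set (TangentBundle (𝓡 n) M)) [ChartedSpace (Eu d) S] :
    Prop :=
  ContMDiff (𝓡 d) (𝓡 n).tangent ∞ (Subtype.val : S → TangentBundle (𝓡 n) M) ∧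
  ∀ v : S, Function.Injective
    (mfderiv (𝓡 d) (𝓡 n).tangent (Subtype.val : S → TangentBundle (𝓡 n) M) v)

/-- The metric `ĝ` induced on a submanifold `S` of `TM` by the Sasaki metric of `g`. -/
def sasakiOn (g : LorentzianMetric n M) {d : ℕ} {S : Set (TangentBundle (𝓡 n) M)}
    [ChartedSpace (Eu d) S] (v : S) :
    TangentSpace (𝓡 d) v →L[ℝ] TangentSpace (𝓡 d) v →L[ℝ] ℝ :=
  pullbackForm (mfderiv (𝓡 d) (𝓡 n).tangent (Subtype.val : S → TangentBundle (𝓡 n) M) v)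
    (sasaki g.val v.1)

/-- The restriction `π|_S : S → M` of the projection `π : TM → M`. -/
def projOn (S : Set (TangentBundle (𝓡 n) M)) (v : S) : M := v.1.proj

end Congruence

end NullCongruence

end

open NullCongruence

/-! In the chart of `TM` at a point, write tangent vectors at `(x, a)` as `(X, A)` and put `c = A +
Γ(X, a)`, so that the Sasaki metric is `h(X, X') + h(c, c')`. The null congruence is the level set
`(0, -1)` of `F(x, a) = (h(a, a), h(a, k))`. Since the connection is metric, `dF(X, A) = (2 h(c, a),
h(c, k) + l(X))` with `l(X) = h(a, ∇_X k)` (`fderiv_congruenceFun`). This is onto, because `a` and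
`k` pair to `-1`; the inverse function theorem then yields slice charts of dimension `2n - 2`
(`exists_straightening`, `exists_sliceChart`).

For the formula, any smooth structure making the inclusion an immersion of this dimension has
tangent spaces `ker dF`, by counting dimensions (`range_inclDeriv`). Vertical vectors are the `(0,
A)` with `A` orthogonal to `a` and `k`. A horizontal vector has `c` orthogonal to all of these,
hence in the span of `a` and `k`; the two tangency equations leave `c = l(X) a`
(`connector_of_horizontal`). The same algebra shows that the induced metric is nondegenerate and
that the two subspaces are complementary.

The geometric input is that the fibres of `TM` are flat and totally geodesic: the Christoffel
symbols of the Sasaki metric vanish on two vertical arguments (`christoffelFirst_sasakiForm`). So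
for `Y` vertical, pairing `∇_ξ Y` with a horizontal `Z` amounts to pairing the ordinary derivative
`∂_ξ Y` with `c(Z) = l(X) a`. Differentiating `h(Y, a) = 0` along the vertical `ξ` gives `h(∂_ξ Y,
a) = -h(Y, ξ)`, and the result is `-l(X) ĝ(ξ, Y)` (`covariantDeriv_vertical`). Only the value of `Y`
at the point remains, whence independence of the extensions. -/

noncomputable section

namespace NullCongruence

set_option maxSynthPendingDepth 3

/-! ### Fields of bilinear forms and their Christoffel symbols on a vector space -/

section Forms

variable {V W : Type*} [NormedAddCommGroup V] [NormedSpace ℝ V]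
  [NormedAddCommGroup W] [NormedSpace ℝ W]

@[simp]
theorem pullbackForm_apply {V W : Type*} [AddCommGroup V] [Module ℝ V] [TopologicalSpace V]
    [IsTopologicalAddGroup V] [ContinuousSMul ℝ V] [AddCommGroup W] [Module ℝ W]
    [TopologicalSpace W] [IsTopologicalAddGroup W] [ContinuousSMul ℝ W]
    (A : V →L[ℝ] W) (B : W →L[ℝ] W →L[ℝ] ℝ) (u w : V) :
    pullbackForm A B u w = B (A u) (A w) := rfl

open Filter Topology

/-- The derivative of a field of bilinear forms, evaluated on fixed vectors. -/
theorem fderiv_form_apply {G : V → (W →L[ℝ] W →L[ℝ] ℝ)} {y : V} (hG : DifferentiableAt ℝ G y)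
    (u : V) (w z : W) : fderiv ℝ G y u w z = fderiv ℝ (fun x => G x w z) y u := by
  have h1 : HasFDerivAt (fun x => G x w z) _ y :=
    ((hG.hasFDerivAt.clm_apply (hasFDerivAt_const w y)).clm_apply (hasFDerivAt_const z y))
  rw [h1.fderiv]
  simp

theorem fderiv_form_symm {G : V → (W →L[ℝ] W →L[ℝ] ℝ)} {y : V} (hG : DifferentiableAt ℝ G y)
    (hs : ∀ᶠ x in 𝓝 y, ∀ w z, G x w z = G x z w) (u : V) (w z : W) :
    fderiv ℝ G y u w z = fderiv ℝ G y u z w := by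
  rw [fderiv_form_apply hG, fderiv_form_apply hG]
  congr 1
  exact Filter.EventuallyEq.fderiv_eq (hs.mono fun x hx => hx w z)

/-- The derivative of `x ↦ G x (a x) (b x)`. -/
theorem fderiv_form_comp {G : V → (W →L[ℝ] W →L[ℝ] ℝ)} {a b : V → W} {y : V}
    (hG : DifferentiableAt ℝ G y) (ha : DifferentiableAt ℝ a y) (hb : DifferentiableAt ℝ b y)
    (u : V) : fderiv ℝ (fun x => G x (a x) (b x)) y u =
      fderiv ℝ G y u (a y) (b y) + G y (fderiv ℝ a y u) (b y) + G y (a y) (fderiv ℝ b y u) := by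
  have h1 := ((hG.hasFDerivAt.clm_apply ha.hasFDerivAt).clm_apply hb.hasFDerivAt).fderiv
  rw [h1]
  simp
  ring

/-- Christoffel symbols of the first kind of the pullback of a field of bilinear forms. -/
theorem christoffelFirst_pullback {ι : V → W} {S : W → (W →L[ℝ] W →L[ℝ] ℝ)}
    {G : V → (V →L[ℝ] V →L[ℝ] ℝ)} {y : V} (hι : ContDiffAt ℝ ∞ ι y)
    (hS : DifferentiableAt ℝ S (ι y)) (hsymm : ∀ w z, S (ι y) w z = S (ι y) z w)
    (hG : ∀ᶠ x in 𝓝 y, G x = pullbackForm (fderiv ℝ ι x) (S (ι x))) (u w z : V) :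
    christoffelFirst G y u w z =
      christoffelFirst S (ι y) (fderiv ℝ ι y u) (fderiv ℝ ι y w) (fderiv ℝ ι y z) +
        S (ι y) (fderiv ℝ (fderiv ℝ ι) y u w) (fderiv ℝ ι y z) := by
  have hdι : DifferentiableAt ℝ ι y := hι.differentiableAt (by simp)
  have hd2 : DifferentiableAt ℝ (fderiv ℝ ι) y :=
    (hι.fderiv_right (m := ∞) (by simp)).differentiableAt (by simp)
  have hsym2 : IsSymmSndFDerivAt ℝ ι y := hι.isSymmSndFDerivAt (by
    simpa using WithTop.coe_le_coe.2 (le_top : (2 : ℕ∞) ≤ ⊤))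
  have hSι : DifferentiableAt ℝ (fun x => S (ι x)) y := hS.comp y hdι
  have hGd : DifferentiableAt ℝ G y := by
    have : DifferentiableAt ℝ (fun x => pullbackForm (fderiv ℝ ι x) (S (ι x))) y := by
      have h1 : DifferentiableAt ℝ (fun x => (S (ι x)).comp (fderiv ℝ ι x)) y := hSι.clm_comp hd2
      have h2 : DifferentiableAt ℝ
          (fun x => ContinuousLinearMap.precomp ℝ (fderiv ℝ ι x)) y :=
        ((ContinuousLinearMap.compL ℝ V W ℝ).flip).differentiableAt.comp y hd2
      exact h2.clm_comp h1
    exact this.congr_of_eventuallyEq hG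
  have key : ∀ a b c : V, fderiv ℝ G y a b c =
      fderiv ℝ S (ι y) (fderiv ℝ ι y a) (fderiv ℝ ι y b) (fderiv ℝ ι y c) +
      S (ι y) (fderiv ℝ (fderiv ℝ ι) y a b) (fderiv ℝ ι y c) +
      S (ι y) (fderiv ℝ ι y b) (fderiv ℝ (fderiv ℝ ι) y a c) := by
    intro a b c
    rw [fderiv_form_apply hGd]
    have he : (fun x => G x b c) =ᶠ[𝓝 y] fun x => S (ι x) (fderiv ℝ ι x b) (fderiv ℝ ι x c) :=
      hG.mono fun x hx => by simp [hx]
    have hb : ∀ b : V, HasFDerivAt (fun x => fderiv ℝ ι x b) ((fderiv ℝ (fderiv ℝ ι) y).flip b) y :=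
      fun b => by simpa using hd2.hasFDerivAt.clm_apply (hasFDerivAt_const b y)
    rw [he.fderiv_eq, fderiv_form_comp hSι (hb b).differentiableAt (hb c).differentiableAt,
      (hb b).fderiv, (hb c).fderiv]
    have hc : fderiv ℝ (fun x => S (ι x)) y = (fderiv ℝ S (ι y)).comp (fderiv ℝ ι y) :=
      fderiv_comp y hS hdι
    rw [hc]
    rfl
  -- Of the six second-derivative terms, symmetry of the second derivative and of `S` cancels four
  -- in pairs; the other two coincide and absorb the factor `1 / 2`.
  rw [christoffelFirst_apply, christoffelFirst_apply, key, key, key, hsym2.eq z u, hsym2.eq z w,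
    hsym2.eq w u, hsymm (fderiv ℝ ι y w), hsymm (fderiv ℝ ι y u)]
  ring

/-- The Levi-Civita connection is metric. -/
theorem fderiv_form_eq_christoffel {h : V → (V →L[ℝ] V →L[ℝ] ℝ)} {x : V}
    (hd : DifferentiableAt ℝ h x) (hs : ∀ᶠ y in 𝓝 x, ∀ w z, h y w z = h y z w)
    (hi : (h x).IsInvertible) (u w z : V) :
    fderiv ℝ h x u w z = h x (christoffel h x u w) z + h x w (christoffel h x u z) := by
  have hsx := hs.self_of_nhds
  rw [hsx w, christoffel_spec _ _ _ _ _ hi, christoffel_spec _ _ _ _ _ hi,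
    christoffelFirst_apply, christoffelFirst_apply, fderiv_form_symm hd hs u z w]
  ring

theorem contDiffAt_christoffel [FiniteDimensional ℝ V] {h : V → (V →L[ℝ] V →L[ℝ] ℝ)} {x : V}
    (hd : ContDiffAt ℝ ∞ h x) (hi : (h x).IsInvertible) :
    ContDiffAt ℝ ∞ (christoffel h) x := by
  have : CompleteSpace V := FiniteDimensional.complete ℝ V
  have h0 : ContDiffAt ℝ ∞ (fderiv ℝ h) x := hd.fderiv_right (by simp)
  have h1 : ContDiffAt ℝ ∞ (christoffelFirst h) x := by
    have hA : ContDiffAt ℝ ∞ (fun y => (fderiv ℝ h y).flip) x :=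
      (ContinuousLinearMap.flipₗᵢ ℝ V V (V →L[ℝ] ℝ)).toContinuousLinearEquiv.toContinuousLinearMap.contDiff.contDiffAt.comp
        x h0
    have hB := (contDiffAt_const (n := ∞) (x := x)
      (c := (ContinuousLinearMap.flipₗᵢ ℝ V V ℝ).toContinuousLinearEquiv.toContinuousLinearMap)
      ).clm_comp hA
    exact ((h0.add hA).sub hB).const_smul (1 / 2 : ℝ)
  have h2 : ContDiffAt ℝ ∞ (fun y => ContinuousLinearMap.inverse (h y)) x :=
    (hi.contDiffAt_map_inverse).comp x hd
  have h3 : ContDiffAt ℝ ∞ (fun y => ContinuousLinearMap.compL ℝ V (V →L[ℝ] ℝ) V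
      (ContinuousLinearMap.inverse (h y))) x :=
    (ContinuousLinearMap.compL ℝ V (V →L[ℝ] ℝ) V).contDiff.contDiffAt.comp x h2
  exact h3.clm_comp h1

/-- Transformation law of the Christoffel symbols under a change of coordinates `φ`. -/
theorem christoffel_pullback {φ : V → W} {h : W → (W →L[ℝ] W →L[ℝ] ℝ)}
    {h' : V → (V →L[ℝ] V →L[ℝ] ℝ)} {y : V} (hφ : ContDiffAt ℝ ∞ φ y)
    (hh : DifferentiableAt ℝ h (φ y)) (hsymm : ∀ w z, h (φ y) w z = h (φ y) z w)
    (hi : (h (φ y)).IsInvertible) (hi' : (h' y).IsInvertible)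
    (hsurj : Function.Surjective (fderiv ℝ φ y))
    (hh' : ∀ᶠ x in 𝓝 y, h' x = pullbackForm (fderiv ℝ φ x) (h (φ x))) (u w : V) :
    fderiv ℝ φ y (christoffel h' y u w) =
      christoffel h (φ y) (fderiv ℝ φ y u) (fderiv ℝ φ y w) + fderiv ℝ (fderiv ℝ φ) y u w := by
  -- Both sides are compared through `h`; surjectivity of the differential of `φ` allows testing
  -- only on vectors in its image, where the first-kind law applies.
  apply hi.injective
  ext z'
  obtain ⟨z, rfl⟩ := hsurj z'
  have h1 := christoffel_spec h' y u w z hi'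
  rw [christoffelFirst_pullback hφ hh hsymm hh', hh'.self_of_nhds, pullbackForm_apply] at h1
  rw [h1, map_add, add_apply, christoffel_spec _ _ _ _ _ hi]

end Forms

/-! ### The Sasaki metric on an open set of a vector space -/

section SasakiForm

open Filter Topology

variable {V E : Type*} [NormedAddCommGroup V] [NormedSpace ℝ V]
  [NormedAddCommGroup E] [NormedSpace ℝ E]

/-- The Sasaki metric, at the point `x = (y, a)` of the tangent bundle of an open set of a vector
space, of a metric `h` on this set. -/
def sasakiForm (h : V → (V →L[ℝ] V →L[ℝ] ℝ)) (x : V × V) : V × V →L[ℝ] V × V →L[ℝ] ℝ :=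
  pullbackForm (ContinuousLinearMap.fst ℝ V V) (h x.1) +
    pullbackForm (ContinuousLinearMap.snd ℝ V V +
      ((christoffel h x.1).flip x.2).comp (ContinuousLinearMap.fst ℝ V V)) (h x.1)

theorem sasakiForm_apply (h : V → (V →L[ℝ] V →L[ℝ] ℝ)) (x X Y : V × V) :
    sasakiForm h x X Y = h x.1 X.1 Y.1 +
      h x.1 (X.2 + christoffel h x.1 X.1 x.2) (Y.2 + christoffel h x.1 Y.1 x.2) := rfl

theorem differentiableAt_sasakiForm [FiniteDimensional ℝ V] {h : V → (V →L[ℝ] V →L[ℝ] ℝ)}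
    {x : V × V} (hd : ContDiffAt ℝ ∞ h x.1) (hi : (h x.1).IsInvertible) :
    DifferentiableAt ℝ (sasakiForm h) x := by
  have h1 : DifferentiableAt ℝ (fun y : V × V => h y.1) x :=
    (hd.differentiableAt (by simp)).comp x differentiableAt_fst
  have h2 : DifferentiableAt ℝ (fun y : V × V => christoffel h y.1) x :=
    ((contDiffAt_christoffel hd hi).differentiableAt (by simp)).comp x differentiableAt_fst
  have h3 : DifferentiableAt ℝ (fun y : V × V => (christoffel h y.1).flip) x :=
    (ContinuousLinearMap.flipₗᵢ ℝ V V V).toContinuousLinearEquiv.toContinuousLinearMap.differentiableAt.comp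
      x h2
  have h4 : DifferentiableAt ℝ (fun y : V × V => ContinuousLinearMap.snd ℝ V V +
      ((christoffel h y.1).flip y.2).comp (ContinuousLinearMap.fst ℝ V V)) x :=
    (differentiableAt_const _).add ((h3.clm_apply differentiableAt_snd).clm_comp
      (differentiableAt_const _))
  have h5 : ∀ {A : V × V → (V × V →L[ℝ] V)}, DifferentiableAt ℝ A x →
      DifferentiableAt ℝ (fun y => pullbackForm (A y) (h y.1)) x := fun hA =>
    (((ContinuousLinearMap.compL ℝ (V × V) V ℝ).flip).differentiableAt.comp x hA).clm_comp
      (h1.clm_comp hA)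
  exact (h5 (differentiableAt_const _)).add (h5 h4)

/-- The fibres of the tangent bundle are flat and totally geodesic. Moving along the fibre changes
only the connector of `Z`, which contributes `h(ζ, Γ(Z, ξ))` and its mirror image; their sum is the
derivative of `h(ξ, ζ)` along `Z`, by metric compatibility. -/
theorem christoffelFirst_sasakiForm [FiniteDimensional ℝ V] {h : V → (V →L[ℝ] V →L[ℝ] ℝ)}
    {x : V × V} (hd : ContDiffAt ℝ ∞ h x.1) (hi : (h x.1).IsInvertible)
    (hs : ∀ᶠ y in 𝓝 x.1, ∀ w z, h y w z = h y z w) (ξ ζ : V) (Z : V × V) :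
    christoffelFirst (sasakiForm h) x (0, ξ) (0, ζ) Z = 0 := by
  have hS := differentiableAt_sasakiForm hd hi
  have hdd : DifferentiableAt ℝ h x.1 := hd.differentiableAt (by simp)
  have h1 : DifferentiableAt ℝ (fun y : V × V => h y.1) x := hdd.comp x differentiableAt_fst
  have h2 : DifferentiableAt ℝ (fun y : V × V => christoffel h y.1) x :=
    ((contDiffAt_christoffel hd hi).differentiableAt (by simp)).comp x differentiableAt_fst
  have e1 : fderiv ℝ (fun y : V × V => h y.1) x = (fderiv ℝ h x.1).comp
      (ContinuousLinearMap.fst ℝ V V) := by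
    have := (hdd.hasFDerivAt.comp x hasFDerivAt_fst).fderiv
    exact this
  have e2 : fderiv ℝ (fun y : V × V => christoffel h y.1) x = (fderiv ℝ (christoffel h) x.1).comp
      (ContinuousLinearMap.fst ℝ V V) := by
    have := (((contDiffAt_christoffel hd hi).differentiableAt
      (by simp)).hasFDerivAt.comp x hasFDerivAt_fst).fderiv
    exact this
  have key1 : ∀ ξ ζ : V, fderiv ℝ (sasakiForm h) x (0, ξ) (0, ζ) Z =
      h x.1 ζ (christoffel h x.1 Z.1 ξ) := by
    intro ξ ζ
    rw [fderiv_form_apply hS]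
    simp only [sasakiForm_apply, map_zero, zero_apply, zero_add, add_zero]
    have hb : HasFDerivAt (fun y : V × V => Z.2 + christoffel h y.1 Z.1 y.2) _ x :=
      (((h2.hasFDerivAt.clm_apply (hasFDerivAt_const Z.1 x)).clm_apply hasFDerivAt_snd).const_add
        Z.2)
    rw [fderiv_form_comp h1 (differentiableAt_const _) hb.differentiableAt, hb.fderiv, e1, e2]
    simp
  have key2 : fderiv ℝ (sasakiForm h) x Z (0, ξ) (0, ζ) = fderiv ℝ h x.1 Z.1 ξ ζ := by
    rw [fderiv_form_apply hS]
    simp only [sasakiForm_apply, map_zero, zero_apply, zero_add, add_zero]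
    rw [fderiv_form_comp h1 (differentiableAt_const _) (differentiableAt_const _), e1]
    simp
  rw [christoffelFirst_apply, key1, key1, key2, fderiv_form_eq_christoffel hdd hs hi,
    hs.self_of_nhds (christoffel h x.1 Z.1 ξ)]
  ring

/-- The covariant derivative of a vertical field `Y` in a vertical direction `ξ`, on a submanifold
of the tangent bundle, parametrized by `ι`, whose vertical vectors at `(y, a)` are orthogonal
to `a`. -/
theorem covariantDeriv_vertical [FiniteDimensional ℝ V] {h : V → (V →L[ℝ] V →L[ℝ] ℝ)}
    {ι : E → V × V} {G : E → (E →L[ℝ] E →L[ℝ] ℝ)} {y : E} (hι : ContDiffAt ℝ ∞ ι y)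
    (hd : ContDiffAt ℝ ∞ h (ι y).1) (hi : (h (ι y).1).IsInvertible)
    (hs : ∀ᶠ x in 𝓝 (ι y).1, ∀ w z, h x w z = h x z w)
    (hG : ∀ᶠ x in 𝓝 y, G x = pullbackForm (fderiv ℝ ι x) (sasakiForm h (ι x)))
    {Y : E → E} (hY : DifferentiableAt ℝ Y y)
    (hYv : ∀ᶠ x in 𝓝 y, (fderiv ℝ ι x (Y x)).1 = 0)
    (hYo : ∀ᶠ x in 𝓝 y, h (ι x).1 (fderiv ℝ ι x (Y x)).2 (ι x).2 = 0)
    {ξ Z : E} (hξ : (fderiv ℝ ι y ξ).1 = 0) {α : ℝ}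
    (hZ : (fderiv ℝ ι y Z).2 + christoffel h (ι y).1 (fderiv ℝ ι y Z).1 (ι y).2 = α • (ι y).2) :
    G y (fderiv ℝ Y y ξ) Z + christoffelFirst G y ξ (Y y) Z = -α * G y ξ (Y y) := by
  have hdι : DifferentiableAt ℝ ι y := hι.differentiableAt (by simp)
  have hdd : DifferentiableAt ℝ h (ι y).1 := hd.differentiableAt (by simp)
  have hd2 : DifferentiableAt ℝ (fderiv ℝ ι) y :=
    (hι.fderiv_right (m := ∞) (by simp)).differentiableAt (by simp)
  have hsx := hs.self_of_nhds
  have hSs : ∀ w z, sasakiForm h (ι y) w z = sasakiForm h (ι y) z w := fun w z => by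
    rw [sasakiForm_apply, sasakiForm_apply, hsx w.1, hsx (w.2 + _)]
  have hW : HasFDerivAt (fun x => fderiv ℝ ι x (Y x)) _ y :=
    hd2.hasFDerivAt.clm_apply hY.hasFDerivAt
  have hWe := hW.fderiv
  set D := fderiv ℝ ι y with hDdef
  have hYv0 := hYv.self_of_nhds
  have hYo0 := hYo.self_of_nhds
  rw [← hDdef] at hYv0 hYo0
  have hDξ : D ξ = (0, (D ξ).2) := Prod.ext hξ rfl
  have hDY : D (Y y) = (0, (D (Y y)).2) := Prod.ext hYv0 rfl
  rw [christoffelFirst_pullback hι (differentiableAt_sasakiForm hd hi) hSs hG, ← hDdef, hDξ, hDY,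
    christoffelFirst_sasakiForm hd hi hs, hG.self_of_nhds, pullbackForm_apply, pullbackForm_apply,
    zero_add, ← hDdef]
  -- The derivative of `Y` and the second derivative of `ι` left over by the pullback law are
  -- together the derivative of the pushed-forward field `x ↦ dι_x (Y x)`.
  have hsum : sasakiForm h (ι y) (D (fderiv ℝ Y y ξ)) (D Z) +
      sasakiForm h (ι y) (fderiv ℝ (fderiv ℝ ι) y ξ (Y y)) (D Z) =
      sasakiForm h (ι y) (fderiv ℝ (fun x => fderiv ℝ ι x (Y x)) y ξ) (D Z) := by
    rw [hWe, ← add_apply, ← map_add]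
    simp
  have hW1 : (fderiv ℝ (fun x => fderiv ℝ ι x (Y x)) y ξ).1 = 0 := by
    have h1 : fderiv ℝ (fun x => (fderiv ℝ ι x (Y x)).1) y = 0 := by
      have : (fun x => (fderiv ℝ ι x (Y x)).1) =ᶠ[𝓝 y] fun _ => (0 : V) := hYv
      rw [this.fderiv_eq]
      simp
    have h2 := (hasFDerivAt_fst.comp y hW.differentiableAt.hasFDerivAt).fderiv
    have h3 := DFunLike.congr_fun (h2.symm.trans h1) ξ
    exact h3
  have h2 : fderiv ℝ (fun x => (fderiv ℝ ι x (Y x)).2) y ξ =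
      (fderiv ℝ (fun x => fderiv ℝ ι x (Y x)) y ξ).2 := by
    have h2 := (hasFDerivAt_snd.comp y hW.differentiableAt.hasFDerivAt).fderiv
    exact DFunLike.congr_fun h2 ξ
  have hx1 : HasFDerivAt (fun x => (ι x).1) ((ContinuousLinearMap.fst ℝ V V).comp D) y :=
    hasFDerivAt_fst.comp y hdι.hasFDerivAt
  have hx2 : HasFDerivAt (fun x => (ι x).2) ((ContinuousLinearMap.snd ℝ V V).comp D) y :=
    hasFDerivAt_snd.comp y hdι.hasFDerivAt
  have hh1 : HasFDerivAt (fun x => h (ι x).1)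
      ((fderiv ℝ h (ι y).1).comp ((ContinuousLinearMap.fst ℝ V V).comp D)) y :=
    hdd.hasFDerivAt.comp y hx1
  have hW2 : DifferentiableAt ℝ (fun x => (fderiv ℝ ι x (Y x)).2) y :=
    differentiableAt_snd.comp y hW.differentiableAt
  -- Differentiating the orthogonality relation along `ξ`: as `ξ` does not move the base point, `h`
  -- is constant to first order and only the derivatives of the field and of `a` survive.
  have h3 : fderiv ℝ (fun x => h (ι x).1 (fderiv ℝ ι x (Y x)).2 (ι x).2) y ξ = 0 := by
    have : (fun x => h (ι x).1 (fderiv ℝ ι x (Y x)).2 (ι x).2) =ᶠ[𝓝 y] fun _ => (0 : ℝ) := hYo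
    rw [this.fderiv_eq]
    simp
  rw [fderiv_form_comp hh1.differentiableAt hW2 hx2.differentiableAt, hh1.fderiv, hx2.fderiv, h2]
    at h3
  simp only [ContinuousLinearMap.comp_apply, ContinuousLinearMap.coe_fst',
    ContinuousLinearMap.coe_snd', hξ, map_zero, zero_apply, zero_add] at h3
  rw [hsum, sasakiForm_apply, hW1, hZ, sasakiForm_apply]
  simp only [map_zero, zero_apply, add_zero, zero_add, map_smul, smul_eq_mul, hYv0, hξ]
  rw [hsx (D ξ).2]
  rw [← hDdef] at h3
  linear_combination α * h3

end SasakiForm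

/-! ### Projection away from a null vector and a vector pairing with it to `-1` -/

section Orthogonal

variable {V : Type*} [AddCommGroup V] [Module ℝ V] [TopologicalSpace V]

/-- The orthogonal projection onto `{v, k}ᗮ`, for `v` null with `B v k = -1`. -/
def orthProj (B : V →L[ℝ] V →L[ℝ] ℝ) (v k c : V) : V :=
  c + (B c k + B c v * B k k) • v + B c v • k

variable {B : V →L[ℝ] V →L[ℝ] ℝ} {v k : V}

theorem orthProj_left (hs : ∀ u w, B u w = B w u) (hv : B v v = 0) (hvk : B v k = -1) (c : V) :
    B (orthProj B v k c) v = 0 := by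
  simp [orthProj, hv, hs k v, hvk]

theorem orthProj_right (hvk : B v k = -1) (c : V) :
    B (orthProj B v k c) k = 0 := by
  simp [orthProj, hvk]

theorem orthProj_inner (c : V) {b : V} (hbv : B b v = 0)
    (hbk : B b k = 0) : B b (orthProj B v k c) = B b c := by
  simp [orthProj, hbv, hbk]

/-- The coefficient of `k` in the projection formula is `B c v`, so for `c` orthogonal to `v` only a
multiple of `v` is removed. -/
theorem self_sub_orthProj_inner {c : V} (hc : B c v = 0) : c - orthProj B v k c = -(B c k) • v := by
  simp [orthProj, hc]

end Orthogonal

/-! ### Charts of a manifold and of its tangent bundle -/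

theorem fieldInChart_apply {m : ℕ} {N : Type*} [TopologicalSpace N] [ChartedSpace (Eu m) N]
    (Y : Π q : N, TangentSpace (𝓡 m) q)
    {p q : N} (hq : q ∈ (extChartAt (𝓡 m) p).source) :
    fieldInChart Y p (extChartAt (𝓡 m) p q) = chartDeriv p q (Y q) := by
  obtain ⟨y, hy, rfl⟩ : ∃ y ∈ (extChartAt (𝓡 m) p).target, (extChartAt (𝓡 m) p).symm y = q :=
    ⟨_, (extChartAt (𝓡 m) p).map_source hq, (extChartAt (𝓡 m) p).left_inv hq⟩
  rw [(extChartAt (𝓡 m) p).right_inv hy, fieldInChart]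

section Charts

open Filter Topology

variable {m : ℕ} {N : Type*} [TopologicalSpace N] [ChartedSpace (Eu m) N] [IsManifold (𝓡 m) ∞ N]

theorem mfderivWithin_range_self {F : Type*} [TopologicalSpace F] {H : Type*} [TopologicalSpace H]
    {E' : Type*} [NormedAddCommGroup E'] [NormedSpace ℝ E'] {I' : ModelWithCorners ℝ E' H}
    [ChartedSpace H F] (f : Eu m → F) (y : Eu m) :
    mfderivWithin 𝓘(ℝ, Eu m) I' f (Set.range (𝓡 m)) y = mfderiv 𝓘(ℝ, Eu m) I' f y := by
  rw [(𝓡 m).range_eq_univ, mfderivWithin_univ]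

theorem isManifold_one : IsManifold (𝓡 m) 1 N := IsManifold.of_le (n := ∞) (by simp)

theorem chartDeriv_chartSymmDeriv {p : N} {y : Eu m} (hy : y ∈ (extChartAt (𝓡 m) p).target)
    (u : Eu m) : chartDeriv p ((extChartAt (𝓡 m) p).symm y) (chartSymmDeriv p y u) = u := by
  have := isManifold_one (m := m) (N := N)
  have h := mfderiv_extChartAt_comp_mfderivWithin_extChartAt_symm (I := 𝓡 m) hy
  rw [mfderivWithin_range_self] at h
  exact DFunLike.congr_fun h u

theorem chartSymmDeriv_chartDeriv {p : N} {y : Eu m} (hy : y ∈ (extChartAt (𝓡 m) p).target)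
    (u : TangentSpace (𝓡 m) ((extChartAt (𝓡 m) p).symm y)) :
    chartSymmDeriv p y (chartDeriv p ((extChartAt (𝓡 m) p).symm y) u) = u := by
  have := isManifold_one (m := m) (N := N)
  have h := mfderivWithin_extChartAt_symm_comp_mfderiv_extChartAt (I := 𝓡 m) hy
  rw [mfderivWithin_range_self] at h
  exact DFunLike.congr_fun h u

theorem isInvertible_chartDeriv {p q : N} (hq : q ∈ (extChartAt (𝓡 m) p).source) :
    (chartDeriv (m := m) p q).IsInvertible := by
  have := isManifold_one (m := m) (N := N)
  exact isInvertible_mfderiv_extChartAt hq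

theorem metricInChart_apply (h : Π q : N, TangentSpace (𝓡 m) q →L[ℝ] TangentSpace (𝓡 m) q →L[ℝ] ℝ)
    {p q : N} (hq : q ∈ (extChartAt (𝓡 m) p).source) (u w : TangentSpace (𝓡 m) q) :
    metricInChart h p (extChartAt (𝓡 m) p q) (chartDeriv p q u) (chartDeriv p q w) = h q u w := by
  obtain ⟨y, hy, rfl⟩ : ∃ y ∈ (extChartAt (𝓡 m) p).target, (extChartAt (𝓡 m) p).symm y = q :=
    ⟨_, (extChartAt (𝓡 m) p).map_source hq, (extChartAt (𝓡 m) p).left_inv hq⟩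
  rw [(extChartAt (𝓡 m) p).right_inv hy, metricInChart, pullbackForm_apply,
    chartSymmDeriv_chartDeriv hy, chartSymmDeriv_chartDeriv hy]

/-- The chart of the tangent bundle at `v`. -/
theorem extChartAt_tangent (v w : TangentBundle (𝓡 m) N)
    (hw : w.proj ∈ (extChartAt (𝓡 m) v.proj).source) :
    extChartAt (𝓡 m).tangent v w =
      (extChartAt (𝓡 m) v.proj w.proj, chartDeriv v.proj w.proj w.2) := by
  have := isManifold_one (m := m) (N := N)
  rw [extChartAt_source] at hw
  have hb : w.proj ∈ (trivializationAt (Eu m) (TangentSpace (𝓡 m)) v.proj).baseSet := hw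
  have h := TangentBundle.continuousLinearMapAt_trivializationAt (I := 𝓡 m) hw
  have h2 := DFunLike.congr_fun h w.2
  rw [FiberBundle.extChartAt]
  refine Prod.ext rfl ?_
  rw [chartDeriv, ← h2]
  rw [Bundle.Trivialization.continuousLinearMapAt_apply,
    Bundle.Trivialization.linearMapAt_apply, if_pos hb]
  rfl

theorem extChartAt_tangent_source (v : TangentBundle (𝓡 m) N) :
    (extChartAt (𝓡 m).tangent v).source = {w | w.proj ∈ (extChartAt (𝓡 m) v.proj).source} := by
  ext w
  rw [extChartAt_source, extChartAt_source]
  exact TangentBundle.mem_chart_source_iff w v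

/-- The chart of `N` at `p` is smooth on its source. -/
theorem contMDiffAt_chart {p q : N} (hq : q ∈ (extChartAt (𝓡 m) p).source) :
    ContMDiffAt (𝓡 m) 𝓘(ℝ, Eu m) ∞ (extChartAt (𝓡 m) p) q :=
  contMDiffAt_extChartAt' (by rwa [extChartAt_source] at hq)

theorem contMDiffAt_chart_symm {p : N} {y : Eu m} (hy : y ∈ (extChartAt (𝓡 m) p).target) :
    ContMDiffAt 𝓘(ℝ, Eu m) (𝓡 m) ∞ (extChartAt (𝓡 m) p).symm y :=
  (contMDiffOn_extChartAt_symm p).contMDiffAt ((isOpen_extChartAt_target p).mem_nhds hy)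

theorem contMDiffAt_chart_tangent {v w : TangentBundle (𝓡 m) N}
    (hw : w.proj ∈ (extChartAt (𝓡 m) v.proj).source) :
    ContMDiffAt (𝓡 m).tangent 𝓘(ℝ, Eu m × Eu m) ∞ (extChartAt (𝓡 m).tangent v) w := by
  have : IsManifold (𝓡 m) (∞ + 1) N := by simpa
  refine contMDiffAt_extChartAt' ?_
  rw [TangentBundle.mem_chart_source_iff]
  rwa [extChartAt_source] at hw

theorem contDiffAt_fieldInChart {Y : Π q : N, TangentSpace (𝓡 m) q} {p : N} {y : Eu m}
    (hy : y ∈ (extChartAt (𝓡 m) p).target)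
    (hY : ContMDiffAt (𝓡 m) (𝓡 m).tangent ∞ (fun q => (⟨q, Y q⟩ : TangentBundle (𝓡 m) N))
      ((extChartAt (𝓡 m) p).symm y)) :
    ContDiffAt ℝ ∞ (fieldInChart Y p) y := by
  have hq := (extChartAt (𝓡 m) p).map_target hy
  have h1 := (hY.comp y (contMDiffAt_chart_symm hy))
  have h2 : ContMDiffAt 𝓘(ℝ, Eu m) 𝓘(ℝ, Eu m × Eu m) ∞ _ y :=
    (contMDiffAt_chart_tangent (v := ⟨p, 0⟩) (w := ⟨_, Y ((extChartAt (𝓡 m) p).symm y)⟩) hq).comp y h1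
  refine (contDiffAt_snd.comp y h2.contDiffAt).congr_of_eventuallyEq ?_
  filter_upwards [(isOpen_extChartAt_target p).mem_nhds hy] with z hz
  exact (congrArg Prod.snd (extChartAt_tangent ⟨p, 0⟩ ⟨_, Y ((extChartAt (𝓡 m) p).symm z)⟩
    ((extChartAt (𝓡 m) p).map_target hz))).symm

/-- A coordinate vector field is the inverse chart of the tangent bundle applied to `(z, u)` with
`u` constant. -/
theorem contMDiffAt_chartSymmDeriv {p : N} {y : Eu m} (hy : y ∈ (extChartAt (𝓡 m) p).target)
    (u : Eu m) : ContMDiffAt 𝓘(ℝ, Eu m) (𝓡 m).tangent ∞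
      (fun y => (⟨(extChartAt (𝓡 m) p).symm y, chartSymmDeriv p y u⟩ : TangentBundle (𝓡 m) N)) y := by
  have : IsManifold (𝓡 m) (∞ + 1) N := by simpa
  have h1 : ContMDiffAt 𝓘(ℝ, Eu m × Eu m) (𝓡 m).tangent ∞
      (extChartAt (𝓡 m).tangent (⟨p, 0⟩ : TangentBundle (𝓡 m) N)).symm (y, u) := by
    refine (contMDiffOn_extChartAt_symm _).contMDiffAt ((isOpen_extChartAt_target _).mem_nhds ?_)
    rw [FiberBundle.extChartAt_target]
    refine ⟨⟨hy, ?_⟩, trivial⟩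
    have := (extChartAt (𝓡 m) p).map_target hy
    rwa [extChartAt_source] at this
  have h2 : ContMDiffAt 𝓘(ℝ, Eu m) 𝓘(ℝ, Eu m × Eu m) ∞ (fun z : Eu m => (z, u)) y :=
    (contDiffAt_id.prodMk contDiffAt_const).contMDiffAt
  refine (h1.comp y h2).congr_of_eventuallyEq ?_
  filter_upwards [(isOpen_extChartAt_target p).mem_nhds hy] with z hz
  have hq := (extChartAt (𝓡 m) p).map_target hz
  have h3 : extChartAt (𝓡 m).tangent (⟨p, 0⟩ : TangentBundle (𝓡 m) N)
      (⟨(extChartAt (𝓡 m) p).symm z, chartSymmDeriv p z u⟩) = (z, u) := by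
    have h4 := extChartAt_tangent (⟨p, 0⟩ : TangentBundle (𝓡 m) N)
      ⟨(extChartAt (𝓡 m) p).symm z, chartSymmDeriv p z u⟩ hq
    rw [h4]
    dsimp only
    rw [(extChartAt (𝓡 m) p).right_inv hz, chartDeriv_chartSymmDeriv hz]
  rw [Function.comp_apply, ← h3, (extChartAt (𝓡 m).tangent _).left_inv]
  rw [extChartAt_tangent_source]
  exact hq

theorem contDiffAt_metricInChart (g : LorentzianMetric m N) {p : N} {y : Eu m}
    (hy : y ∈ (extChartAt (𝓡 m) p).target) : ContDiffAt ℝ ∞ (metricInChart g.val p) y := by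
  have hopen := isOpen_extChartAt_target (I := 𝓡 m) p
  refine ContDiffOn.contDiffAt (s := (extChartAt (𝓡 m) p).target) ?_ (hopen.mem_nhds hy)
  -- In finite dimension, smoothness of a form is tested on constant vectors, one slot at a time;
  -- these become coordinate fields on the manifold.
  rw [contDiffOn_clm_apply]
  intro u
  rw [contDiffOn_clm_apply]
  intro w z hz
  refine ContDiffAt.contDiffWithinAt ?_
  have h1 := (g.contMDiff.contMDiffAt (x := (extChartAt (𝓡 m) p).symm z)).comp z
    (contMDiffAt_chart_symm hz)
  have h2 : ContMDiffAt 𝓘(ℝ, Eu m) (𝓘(ℝ, Eu m).prod 𝓘(ℝ, ℝ)) ∞ _ z :=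
    ContMDiffAt.clm_bundle_apply₂ (F₁ := Eu m) (F₂ := Eu m) (F₃ := ℝ)
      (E₁ := fun q : N => TangentSpace (𝓡 m) q) (E₂ := fun q : N => TangentSpace (𝓡 m) q)
      (E₃ := fun _ : N => ℝ) (b := fun y => (extChartAt (𝓡 m) p).symm y) h1
      (contMDiffAt_chartSymmDeriv hz u) (contMDiffAt_chartSymmDeriv hz w)
  have h3 := (Bundle.contMDiffAt_totalSpace.1 h2).2
  exact h3.contDiffAt

end Charts

/-! ### Change of chart, and the Sasaki metric in coordinates -/

section SasakiInChart

open Filter Topology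

theorem isInvertible_of_nondegenerate {V : Type*} [NormedAddCommGroup V] [NormedSpace ℝ V]
    [FiniteDimensional ℝ V] (B : V →L[ℝ] V →L[ℝ] ℝ) (hB : ∀ u, (∀ w, B u w = 0) → u = 0) :
    B.IsInvertible := by
  have hinj : Function.Injective (B : V →ₗ[ℝ] V →L[ℝ] ℝ) := by
    rw [injective_iff_map_eq_zero]
    exact fun u hu => hB u fun w => DFunLike.congr_fun hu w
  have hfin : Module.finrank ℝ V = Module.finrank ℝ (V →L[ℝ] ℝ) := by
    rw [← (LinearMap.toContinuousLinearMap (E := V) (F' := ℝ) (𝕜 := ℝ)).finrank_eq]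
    exact (Subspace.dual_finrank_eq).symm
  refine ⟨(LinearEquiv.ofInjectiveOfFinrankEq _ hinj hfin).toContinuousLinearEquiv, ?_⟩
  ext u w
  rfl

/-- The derivative of the tangent map `(x, a) ↦ (φ x, φ'(x) a)`. -/
theorem hasFDerivAt_tangentMap {V W : Type*} [NormedAddCommGroup V] [NormedSpace ℝ V]
    [NormedAddCommGroup W] [NormedSpace ℝ W] {φ : V → W} {x : V × V}
    (hφ : ContDiffAt ℝ ∞ φ x.1) :
    HasFDerivAt (fun x : V × V => (φ x.1, fderiv ℝ φ x.1 x.2))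
      (((fderiv ℝ φ x.1).comp (ContinuousLinearMap.fst ℝ V V)).prod
        ((fderiv ℝ φ x.1).comp (ContinuousLinearMap.snd ℝ V V) +
          ((fderiv ℝ (fderiv ℝ φ) x.1).comp (ContinuousLinearMap.fst ℝ V V)).flip x.2)) x :=
  have hd1 : HasFDerivAt φ (fderiv ℝ φ x.1) x.1 := (hφ.differentiableAt (by simp)).hasFDerivAt
  have hd2 : HasFDerivAt (fderiv ℝ φ) (fderiv ℝ (fderiv ℝ φ) x.1) x.1 :=
    ((hφ.fderiv_right (m := ∞) (by simp)).differentiableAt (by simp)).hasFDerivAt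
  (hd1.comp x hasFDerivAt_fst).prodMk
    ((hd2.comp x hasFDerivAt_fst).clm_apply hasFDerivAt_snd)

variable {m : ℕ} {N : Type*} [TopologicalSpace N] [ChartedSpace (Eu m) N] [IsManifold (𝓡 m) ∞ N]

theorem LorentzianMetric.eq_zero_of_forall (g : LorentzianMetric m N) {p : N}
    {u : TangentSpace (𝓡 m) p} (hu : ∀ w, g.val p u w = 0) : u = 0 := by
  obtain ⟨b, hb⟩ := g.signature p
  refine b.ext_elem fun j => ?_
  have h := hu (b j)
  rw [← b.sum_repr u] at h
  simp only [map_sum, map_smul, sum_apply, smul_apply, hb, smul_eq_mul, mul_ite, mul_zero,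
    Finset.sum_ite_eq', Finset.mem_univ, if_true] at h
  split_ifs at h <;> simpa using h

theorem metricInChart_symm (g : LorentzianMetric m N) (p : N) (y u w : Eu m) :
    metricInChart g.val p y u w = metricInChart g.val p y w u :=
  g.symm _ _ _

theorem isInvertible_metricInChart_of_nondegenerate
    {h : Π q : N, TangentSpace (𝓡 m) q →L[ℝ] TangentSpace (𝓡 m) q →L[ℝ] ℝ} {p : N} {y : Eu m}
    (hy : y ∈ (extChartAt (𝓡 m) p).target)
    (hh : ∀ (q : N) (u : TangentSpace (𝓡 m) q), (∀ w, h q u w = 0) → u = 0) :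
    (metricInChart h p y).IsInvertible := by
  refine isInvertible_of_nondegenerate _ fun u hu => ?_
  have h : chartSymmDeriv p y u = 0 := hh _ _ fun w => by
    have h := hu (chartDeriv p _ w)
    rwa [metricInChart, pullbackForm_apply, chartSymmDeriv_chartDeriv hy] at h
  rw [← chartDeriv_chartSymmDeriv hy u, h, map_zero]

theorem isInvertible_metricInChart (g : LorentzianMetric m N) {p : N} {y : Eu m}
    (hy : y ∈ (extChartAt (𝓡 m) p).target) : (metricInChart g.val p y).IsInvertible :=
  isInvertible_metricInChart_of_nondegenerate hy fun _ _ => g.eq_zero_of_forall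

/-- The change of coordinates from the chart of `N` at `q` to the chart at `p`. -/
def chartTransition (p q : N) : Eu m → Eu m := extChartAt (𝓡 m) p ∘ (extChartAt (𝓡 m) q).symm

section Transition

variable {p q : N} {y : Eu m}

theorem contDiffAt_chartTransition (hy : y ∈ (extChartAt (𝓡 m) q).target)
    (hp : (extChartAt (𝓡 m) q).symm y ∈ (extChartAt (𝓡 m) p).source) :
    ContDiffAt ℝ ∞ (chartTransition p q) y :=
  ((contMDiffAt_chart hp).comp y (contMDiffAt_chart_symm hy)).contDiffAt

theorem fderiv_chartTransition (hy : y ∈ (extChartAt (𝓡 m) q).target)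
    (hp : (extChartAt (𝓡 m) q).symm y ∈ (extChartAt (𝓡 m) p).source) (u : Eu m) :
    fderiv ℝ (chartTransition p q) y u =
      chartDeriv p ((extChartAt (𝓡 m) q).symm y) (chartSymmDeriv q y u) := by
  have h := mfderiv_comp y ((contMDiffAt_chart hp).mdifferentiableAt (by simp))
    ((contMDiffAt_chart_symm hy).mdifferentiableAt (by simp))
  rw [← mfderiv_eq_fderiv]
  exact DFunLike.congr_fun h u

theorem eventually_chartTransition (hy : y ∈ (extChartAt (𝓡 m) q).target)
    (hp : (extChartAt (𝓡 m) q).symm y ∈ (extChartAt (𝓡 m) p).source) :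
    ∀ᶠ z in 𝓝 y, z ∈ (extChartAt (𝓡 m) q).target ∧
      (extChartAt (𝓡 m) q).symm z ∈ (extChartAt (𝓡 m) p).source :=
  ((isOpen_extChartAt_target q).eventually_mem hy).and
    ((contMDiffAt_chart_symm hy).continuousAt.eventually_mem
      ((isOpen_extChartAt_source p).mem_nhds hp))

theorem metricInChart_chartTransition
    (h : Π q : N, TangentSpace (𝓡 m) q →L[ℝ] TangentSpace (𝓡 m) q →L[ℝ] ℝ)
    (hy : y ∈ (extChartAt (𝓡 m) q).target)
    (hp : (extChartAt (𝓡 m) q).symm y ∈ (extChartAt (𝓡 m) p).source) :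
    metricInChart h q y = pullbackForm (fderiv ℝ (chartTransition p q) y)
      (metricInChart h p (chartTransition p q y)) := by
  ext u w
  rw [pullbackForm_apply, fderiv_chartTransition hy hp, fderiv_chartTransition hy hp,
    chartTransition, Function.comp_apply, metricInChart_apply _ hp]
  rfl

theorem fderiv_chartTransition_chartDeriv {x : N} (hp : x ∈ (extChartAt (𝓡 m) p).source)
    (hq : x ∈ (extChartAt (𝓡 m) q).source) (u : TangentSpace (𝓡 m) x) :
    fderiv ℝ (chartTransition p q) (extChartAt (𝓡 m) q x) (chartDeriv q x u) =
      chartDeriv p x u := by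
  obtain ⟨y, hy, rfl⟩ : ∃ y ∈ (extChartAt (𝓡 m) q).target, (extChartAt (𝓡 m) q).symm y = x :=
    ⟨_, (extChartAt (𝓡 m) q).map_source hq, (extChartAt (𝓡 m) q).left_inv hq⟩
  rw [(extChartAt (𝓡 m) q).right_inv hy, fderiv_chartTransition hy hp,
    chartSymmDeriv_chartDeriv hy]

end Transition

/-- The differential at `w` of the chart of the tangent bundle at `v`. -/
def tangentChartDeriv (v w : TangentBundle (𝓡 m) N) :
    TangentSpace (𝓡 m).tangent w →L[ℝ] Eu m × Eu m :=
  mfderiv (𝓡 m).tangent 𝓘(ℝ, Eu m × Eu m) (extChartAt (𝓡 m).tangent v) w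

variable {v w : TangentBundle (𝓡 m) N}

theorem eventually_proj_mem_source (hw : w.proj ∈ (extChartAt (𝓡 m) v.proj).source) :
    ∀ᶠ u : TangentBundle (𝓡 m) N in 𝓝 w, u.proj ∈ (extChartAt (𝓡 m) v.proj).source :=
  (FiberBundle.continuous_proj (Eu m) (TangentSpace (𝓡 m) (M := N))).continuousAt.eventually_mem
    ((isOpen_extChartAt_source v.proj).mem_nhds hw)

theorem tangentChartDeriv_fst (hw : w.proj ∈ (extChartAt (𝓡 m) v.proj).source)
    (ξ : TangentSpace (𝓡 m).tangent w) :
    (tangentChartDeriv v w ξ).1 = chartDeriv v.proj w.proj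
      (mfderiv (𝓡 m).tangent (𝓡 m) (fun x : TangentBundle (𝓡 m) N => x.proj) w ξ) := by
  have hproj : MDifferentiableAt (𝓡 m).tangent (𝓡 m)
      (fun x : TangentBundle (𝓡 m) N => x.proj) w :=
    (Bundle.contMDiffAt_proj (n := 1) (TangentSpace (𝓡 m) (M := N))).mdifferentiableAt (by simp)
  have hτ := (contMDiffAt_chart_tangent hw).mdifferentiableAt (by simp)
  have h1 := mfderiv_comp w ((contMDiffAt_chart hw).mdifferentiableAt (by simp)) hproj
  have h2 := ((ContinuousLinearMap.fst ℝ (Eu m) (Eu m)).hasMFDerivAt.comp w hτ.hasMFDerivAt).mfderiv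
  have he : (ContinuousLinearMap.fst ℝ (Eu m) (Eu m)) ∘ extChartAt (𝓡 m).tangent v =ᶠ[𝓝 w]
      extChartAt (𝓡 m) v.proj ∘ (fun x : TangentBundle (𝓡 m) N => x.proj) := by
    filter_upwards [eventually_proj_mem_source hw] with u hu
    exact congrArg Prod.fst (extChartAt_tangent v u hu)
  rw [he.mfderiv_eq] at h2
  exact DFunLike.congr_fun (h2.symm.trans h1) ξ

/-- Change of coordinates for the differentials of the charts of the tangent bundle. -/
theorem tangentChartDeriv_eq (hw : w.proj ∈ (extChartAt (𝓡 m) v.proj).source)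
    (ξ : TangentSpace (𝓡 m).tangent w) :
    tangentChartDeriv v w ξ =
      (fderiv ℝ (chartTransition v.proj w.proj) (extChartAt (𝓡 m) w.proj w.proj)
        (tangentChartDeriv w w ξ).1,
      fderiv ℝ (chartTransition v.proj w.proj) (extChartAt (𝓡 m) w.proj w.proj)
        (tangentChartDeriv w w ξ).2 +
      fderiv ℝ (fderiv ℝ (chartTransition v.proj w.proj)) (extChartAt (𝓡 m) w.proj w.proj)
        (tangentChartDeriv w w ξ).1 (chartDeriv w.proj w.proj w.2)) := by
  set φ := chartTransition (m := m) v.proj w.proj with hφ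
  set y := extChartAt (𝓡 m) w.proj w.proj with hy
  set a := chartDeriv (m := m) w.proj w.proj w.2 with ha
  have hws : w.proj ∈ (extChartAt (𝓡 m) w.proj).source := mem_extChartAt_source w.proj
  have hyt : y ∈ (extChartAt (𝓡 m) w.proj).target := mem_extChartAt_target w.proj
  have hφs : ContDiffAt ℝ ∞ φ y := contDiffAt_chartTransition hyt (by
    rwa [hy, (extChartAt (𝓡 m) w.proj).left_inv hws])
  have hτw : extChartAt (𝓡 m).tangent w w = (y, a) := extChartAt_tangent w w hws
  have hΦ := hasFDerivAt_tangentMap (x := (y, a)) hφs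
  rw [← hτw] at hΦ
  have h2 := (hΦ.hasMFDerivAt.comp w
    ((contMDiffAt_chart_tangent hws).mdifferentiableAt (by simp)).hasMFDerivAt).mfderiv
  have he : (fun x : Eu m × Eu m => (φ x.1, fderiv ℝ φ x.1 x.2)) ∘ extChartAt (𝓡 m).tangent w
      =ᶠ[𝓝 w] extChartAt (𝓡 m).tangent v := by
    filter_upwards [eventually_proj_mem_source hw, eventually_proj_mem_source hws] with u hu huw
    rw [Function.comp_apply, extChartAt_tangent v u hu, extChartAt_tangent w u huw]
    dsimp only
    rw [fderiv_chartTransition_chartDeriv hu huw, hφ, chartTransition, Function.comp_apply,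
      (extChartAt (𝓡 m) w.proj).left_inv huw]
  rw [he.mfderiv_eq] at h2
  have h3 := DFunLike.congr_fun h2 ξ
  refine Eq.trans h3 ?_
  rw [hτw]
  rfl

/-- `connector` is defined in the chart centred at the base point, which moves with `w`, while
derivatives have to be taken in one fixed chart. The second derivative of the transition map in
`tangentChartDeriv_eq` is exactly the inhomogeneous term in the transformation law
`christoffel_pullback`, so the coordinate expression is the same in every chart. -/
theorem chartDeriv_connector (g : LorentzianMetric m N)
    (hw : w.proj ∈ (extChartAt (𝓡 m) v.proj).source) (ξ : TangentSpace (𝓡 m).tangent w) :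
    chartDeriv v.proj w.proj (connector g.val w ξ) = (tangentChartDeriv v w ξ).2 +
      christoffel (metricInChart g.val v.proj) (extChartAt (𝓡 m) v.proj w.proj)
        (tangentChartDeriv v w ξ).1 (chartDeriv v.proj w.proj w.2) := by
  set φ := chartTransition (m := m) v.proj w.proj with hφ
  set y := extChartAt (𝓡 m) w.proj w.proj with hy
  have hws : w.proj ∈ (extChartAt (𝓡 m) w.proj).source := mem_extChartAt_source w.proj
  have hyt : y ∈ (extChartAt (𝓡 m) w.proj).target := mem_extChartAt_target w.proj
  have hyw : (extChartAt (𝓡 m) w.proj).symm y = w.proj := (extChartAt (𝓡 m) w.proj).left_inv hws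
  have hyp : (extChartAt (𝓡 m) w.proj).symm y ∈ (extChartAt (𝓡 m) v.proj).source := by rwa [hyw]
  have hφy : φ y = extChartAt (𝓡 m) v.proj w.proj := congrArg (extChartAt (𝓡 m) v.proj) hyw
  have hφt : φ y ∈ (extChartAt (𝓡 m) v.proj).target := by
    rw [hφy]
    exact (extChartAt (𝓡 m) v.proj).map_source hw
  have hsurj : Function.Surjective (fderiv ℝ φ y) := fun z => by
    obtain ⟨u, hu⟩ := (isInvertible_chartDeriv hw).surjective z
    exact ⟨chartDeriv w.proj w.proj u, by
      rw [hφ, hy, fderiv_chartTransition_chartDeriv hw hws, hu]⟩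
  have hΓ := christoffel_pullback (contDiffAt_chartTransition hyt hyp)
    ((contDiffAt_metricInChart g hφt).differentiableAt (by simp))
    (metricInChart_symm g v.proj _) (isInvertible_metricInChart g hφt)
    (isInvertible_metricInChart g hyt) hsurj
    ((eventually_chartTransition hyt hyp).mono fun z hz =>
      metricInChart_chartTransition g.val hz.1 hz.2)
    (tangentChartDeriv w w ξ).1 (chartDeriv w.proj w.proj w.2)
  have hc : chartDeriv w.proj w.proj (connector g.val w ξ) = (tangentChartDeriv w w ξ).2 +
      christoffel (metricInChart g.val w.proj) y (tangentChartDeriv w w ξ).1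
        (chartDeriv w.proj w.proj w.2) :=
    DFunLike.congr_fun (isInvertible_chartDeriv hws).self_comp_inverse _
  rw [← fderiv_chartTransition_chartDeriv hw hws (connector g.val w ξ), hc, map_add]
  erw [hΓ]
  rw [tangentChartDeriv_eq hw ξ, ← hφy, ← fderiv_chartTransition_chartDeriv hw hws w.2]
  dsimp only
  rw [add_assoc, add_comm (fderiv ℝ (fderiv ℝ (chartTransition v.proj w.proj)) _ _ _)]

/-- The Sasaki metric in coordinates. -/
theorem sasaki_eq_sasakiForm (g : LorentzianMetric m N)
    (hw : w.proj ∈ (extChartAt (𝓡 m) v.proj).source) (ξ η : TangentSpace (𝓡 m).tangent w) :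
    sasaki g.val w ξ η = sasakiForm (metricInChart g.val v.proj)
      (extChartAt (𝓡 m).tangent v w) (tangentChartDeriv v w ξ) (tangentChartDeriv v w η) := by
  rw [sasakiForm_apply, extChartAt_tangent v w hw, tangentChartDeriv_fst hw,
    tangentChartDeriv_fst hw]
  dsimp only
  rw [metricInChart_apply _ hw, ← tangentChartDeriv_fst hw, ← tangentChartDeriv_fst hw,
    ← chartDeriv_connector g hw, ← chartDeriv_connector g hw, metricInChart_apply _ hw]
  rfl

end SasakiInChart

/-! ### Linear algebra of the vertical and horizontal spaces -/

section Splitting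

/-! A space `T` is mapped by `J` isomorphically onto the space of the `(X, A) ∈ V × V` such that
`c = A + Γ X` satisfies `B c a = 0` and `B c k = - l X`, and carries the form
`(u, w) ↦ B (J u).1 (J w).1 + B (c u) (c w)`. -/

variable {V T : Type*} [NormedAddCommGroup V] [NormedSpace ℝ V] [AddCommGroup T] [Module ℝ T]
  {B : V →L[ℝ] V →L[ℝ] ℝ} {a k : V} {Γ : V →L[ℝ] V} {l : V →L[ℝ] ℝ} {J : T →ₗ[ℝ] V × V}

theorem exists_vertical_part (hs : ∀ u w, B u w = B w u) (ha : B a a = 0) (hak : B a k = -1)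
    (hJ : ∀ W : V × V, B (W.2 + Γ W.1) a = 0 ∧ B (W.2 + Γ W.1) k = -l W.1 → ∃ u, J u = W) (c : V) :
    ∃ u, J u = (0, orthProj B a k c) := by
  apply hJ
  simp [orthProj_left hs ha hak, orthProj_right hak]

/-- Pairing such a `b` with an arbitrary `c` is the same as pairing it with the projection of `c`,
which is the second component of a vertical vector; nondegeneracy of `B` concludes. -/
theorem eq_zero_of_vertical_of_orthogonal (hs : ∀ u w, B u w = B w u) (ha : B a a = 0)
    (hak : B a k = -1) (hB : ∀ u, (∀ w, B u w = 0) → u = 0)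
    (hJ : ∀ W : V × V, B (W.2 + Γ W.1) a = 0 ∧ B (W.2 + Γ W.1) k = -l W.1 → ∃ u, J u = W)
    {b : V} (hba : B b a = 0) (hbk : B b k = 0)
    (hb : ∀ u, (J u).1 = 0 → B (J u).2 b = 0) : b = 0 := by
  refine hB b fun c => ?_
  obtain ⟨u, hu⟩ := exists_vertical_part hs ha hak hJ c
  have h := hb u (by rw [hu])
  rwa [hu, hs, orthProj_inner c hba hbk] at h

/-- The projection of the connector to the orthogonal of `a` and `k` vanishes, since it is
orthogonal to all vertical vectors. The connector is also orthogonal to `a`, so it is a multiple of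
`a`, and its product with `k` fixes the factor. -/
theorem connector_of_horizontal (hs : ∀ u w, B u w = B w u) (ha : B a a = 0)
    (hak : B a k = -1) (hB : ∀ u, (∀ w, B u w = 0) → u = 0)
    (hJ : ∀ W : V × V, B (W.2 + Γ W.1) a = 0 ∧ B (W.2 + Γ W.1) k = -l W.1 ↔ ∃ u, J u = W)
    {e : T} (he : ∀ u, (J u).1 = 0 → B (J u).2 ((J e).2 + Γ (J e).1) = 0) :
    (J e).2 + Γ (J e).1 = l (J e).1 • a := by
  obtain ⟨h1, h2⟩ := (hJ (J e)).2 ⟨e, rfl⟩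
  have h3 : orthProj B a k ((J e).2 + Γ (J e).1) = 0 := by
    refine eq_zero_of_vertical_of_orthogonal hs ha hak hB (fun W => (hJ W).1)
      (orthProj_left hs ha hak _) (orthProj_right hak _) fun u hu => ?_
    have h4 := (hJ (J u)).2 ⟨u, rfl⟩
    simp only [hu, map_zero, add_zero, neg_zero] at h4
    rw [orthProj_inner _ h4.1 h4.2, he u hu]
  have h5 := self_sub_orthProj_inner (k := k) h1
  rwa [h3, sub_zero, h2, neg_neg] at h5

/-- Nondegeneracy of the induced form. Orthogonality to vertical vectors makes `e` horizontal; then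
testing against horizontal lifts kills its base component, since the connectors are multiples of the
null vector `a` and do not contribute. -/
theorem eq_zero_of_forall_orthogonal (hs : ∀ u w, B u w = B w u) (ha : B a a = 0)
    (hak : B a k = -1) (hB : ∀ u, (∀ w, B u w = 0) → u = 0) (hinj : Function.Injective J)
    (hJ : ∀ W : V × V, B (W.2 + Γ W.1) a = 0 ∧ B (W.2 + Γ W.1) k = -l W.1 ↔ ∃ u, J u = W)
    {e : T} (he : ∀ u, B (J e).1 (J u).1 + B ((J e).2 + Γ (J e).1) ((J u).2 + Γ (J u).1) = 0) :
    e = 0 := by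
  have hc := connector_of_horizontal hs ha hak hB hJ (e := e) fun u hu => by
    have h := he u
    rw [hu] at h
    simpa [hs (J u).2] using h
  have hX : (J e).1 = 0 := hB _ fun X => by
    -- The horizontal lift of `X`, chosen so that its connector is `l X • a`.
    obtain ⟨u, hu⟩ := (hJ (X, l X • a - Γ X)).1 (by simp [ha, hak])
    have h := he u
    rw [hc, hu] at h
    simpa [ha] using h
  rw [hX, map_zero, map_zero, zero_smul, add_zero] at hc
  exact hinj (by rw [map_zero]; exact Prod.ext hX hc)

end Splitting

/-! ### The null congruence as a regular level set -/

section DefiningFunction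

open Filter Topology

variable {V : Type*} [NormedAddCommGroup V] [NormedSpace ℝ V]

/-- The function `(x, a) ↦ (h_x(a, a), h_x(a, k_x))`, whose fibre over `(0, -1)` is the null
congruence of the vector field `k` for the metric `h`. -/
def congruenceFun (h : V → (V →L[ℝ] V →L[ℝ] ℝ)) (k : V → V) (x : V × V) : ℝ × ℝ :=
  (h x.1 x.2 x.2, h x.1 x.2 (k x.1))

variable {h : V → (V →L[ℝ] V →L[ℝ] ℝ)} {k : V → V} {x : V × V}

theorem contDiffAt_congruenceFun (hd : ContDiffAt ℝ ∞ h x.1) (hk : ContDiffAt ℝ ∞ k x.1) :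
    ContDiffAt ℝ ∞ (congruenceFun h k) x := by
  have h1 : ContDiffAt ℝ ∞ (fun x : V × V => h x.1) x := hd.comp x contDiffAt_fst
  have h2 : ContDiffAt ℝ ∞ (fun x : V × V => k x.1) x := hk.comp x contDiffAt_fst
  exact ((h1.clm_apply contDiffAt_snd).clm_apply contDiffAt_snd).prodMk
    ((h1.clm_apply contDiffAt_snd).clm_apply h2)

/-- Metric compatibility turns the derivative of `h` into Christoffel terms, which complete the
ordinary derivatives of `a` and `k` to covariant ones. -/
theorem fderiv_congruenceFun (hd : ContDiffAt ℝ ∞ h x.1) (hk : ContDiffAt ℝ ∞ k x.1)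
    (hi : (h x.1).IsInvertible) (hs : ∀ᶠ y in 𝓝 x.1, ∀ w z, h y w z = h y z w) (W : V × V) :
    fderiv ℝ (congruenceFun h k) x W =
      (2 * h x.1 (W.2 + christoffel h x.1 W.1 x.2) x.2,
        h x.1 (W.2 + christoffel h x.1 W.1 x.2) (k x.1) +
          h x.1 x.2 (fderiv ℝ k x.1 W.1 + christoffel h x.1 W.1 (k x.1))) := by
  have hdd : HasFDerivAt h (fderiv ℝ h x.1) x.1 := (hd.differentiableAt (by simp)).hasFDerivAt
  have hkd : HasFDerivAt k (fderiv ℝ k x.1) x.1 := (hk.differentiableAt (by simp)).hasFDerivAt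
  have h1 : HasFDerivAt (fun x : V × V => h x.1) _ x := hdd.comp x hasFDerivAt_fst
  have h2 : HasFDerivAt (fun x : V × V => k x.1) _ x := hkd.comp x hasFDerivAt_fst
  have h3 : HasFDerivAt (fun x : V × V => x.2) (ContinuousLinearMap.snd ℝ V V) x := hasFDerivAt_snd
  have hA : DifferentiableAt ℝ (fun x : V × V => h x.1 x.2 x.2) x :=
    ((h1.clm_apply h3).clm_apply h3).differentiableAt
  have hB : DifferentiableAt ℝ (fun x : V × V => h x.1 x.2 (k x.1)) x :=
    ((h1.clm_apply h3).clm_apply h2).differentiableAt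
  have hF := (hA.hasFDerivAt.prodMk hB.hasFDerivAt).fderiv
  change fderiv ℝ (congruenceFun h k) x = _ at hF
  have hsx := hs.self_of_nhds
  rw [hF]
  refine Prod.ext ?_ ?_
  · change fderiv ℝ (fun x : V × V => h x.1 x.2 x.2) x W = _
    rw [fderiv_form_comp h1.differentiableAt h3.differentiableAt h3.differentiableAt, h1.fderiv,
      h3.fderiv]
    simp only [ContinuousLinearMap.comp_apply, ContinuousLinearMap.coe_fst',
      ContinuousLinearMap.coe_snd', map_add, add_apply]
    rw [fderiv_form_eq_christoffel hdd.differentiableAt hs hi, hsx x.2, hsx x.2 W.2]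
    ring
  · change fderiv ℝ (fun x : V × V => h x.1 x.2 (k x.1)) x W = _
    rw [fderiv_form_comp h1.differentiableAt h3.differentiableAt h2.differentiableAt, h1.fderiv,
      h3.fderiv, h2.fderiv]
    simp only [ContinuousLinearMap.comp_apply, ContinuousLinearMap.coe_fst',
      ContinuousLinearMap.coe_snd', map_add, add_apply]
    rw [fderiv_form_eq_christoffel hdd.differentiableAt hs hi]
    ring

theorem surjective_fderiv_congruenceFun (hd : ContDiffAt ℝ ∞ h x.1) (hk : ContDiffAt ℝ ∞ k x.1)
    (hi : (h x.1).IsInvertible) (hs : ∀ᶠ y in 𝓝 x.1, ∀ w z, h y w z = h y z w)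
    (hx : congruenceFun h k x = (0, -1)) :
    Function.Surjective (fderiv ℝ (congruenceFun h k) x) := by
  have h1 : h x.1 x.2 x.2 = 0 := congrArg Prod.fst hx
  have h2 : h x.1 x.2 (k x.1) = -1 := congrArg Prod.snd hx
  have h3 : h x.1 (k x.1) x.2 = -1 := by rw [hs.self_of_nhds, h2]
  rintro ⟨r, s⟩
  -- A vertical vector in the span of `a` and `k`: the condition `2 h(A, a) = r` fixes the
  -- coefficient of `k`, then `h(A, k) = s` fixes that of `a`.
  refine ⟨(0, (-s - r / 2 * h x.1 (k x.1) (k x.1)) • x.2 - (r / 2) • k x.1), ?_⟩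
  rw [fderiv_congruenceFun hd hk hi hs]
  simp only [map_zero, zero_apply, add_zero, map_sub, map_smul, sub_apply, smul_apply, h1, h2, h3,
    smul_eq_mul]
  refine Prod.ext ?_ ?_ <;> dsimp only <;> ring

end DefiningFunction

/-! ### Differentiability of a field known through an injective differential -/

section LeftInverse

open Filter Topology

variable {E F : Type*} [NormedAddCommGroup E] [NormedSpace ℝ E] [FiniteDimensional ℝ E]
  [NormedAddCommGroup F] [NormedSpace ℝ F] [FiniteDimensional ℝ F]

/-- With `L'` a left inverse of `D y`, the map `L' ∘ D x` is the identity at `x = y`, hence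
invertible nearby, and `Y x` is its inverse applied to `L' (W x)`. -/
theorem differentiableAt_of_injective {D : E → (E →L[ℝ] F)} {Y : E → E} {W : E → F} {y : E}
    (hD : DifferentiableAt ℝ D y) (hinj : Function.Injective (D y)) (hW : DifferentiableAt ℝ W y)
    (hY : ∀ᶠ x in 𝓝 y, D x (Y x) = W x) : DifferentiableAt ℝ Y y := by
  have hc : CompleteSpace E := FiniteDimensional.complete ℝ E
  obtain ⟨L, hL⟩ := (D y : E →ₗ[ℝ] F).exists_leftInverse_of_injective (LinearMap.ker_eq_bot.2 hinj)
  set L' : F →L[ℝ] E := LinearMap.toContinuousLinearMap L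
  have hA : DifferentiableAt ℝ (fun x => L'.comp (D x)) y :=
    (differentiableAt_const L').clm_comp hD
  have hA0 : L'.comp (D y) = ContinuousLinearEquiv.refl ℝ E := by
    ext u
    exact DFunLike.congr_fun hL u
  have hinv : DifferentiableAt ℝ (fun x => ContinuousLinearMap.inverse (L'.comp (D x))) y := by
    have h1 : DifferentiableAt ℝ (ContinuousLinearMap.inverse : (E →L[ℝ] E) → _)
        (L'.comp (D y)) := by
      rw [hA0]
      exact (contDiffAt_map_inverse (n := 1) (ContinuousLinearEquiv.refl ℝ E)).differentiableAt
        (by simp)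
    exact h1.comp y hA
  have hev : ∀ᶠ x in 𝓝 y, (L'.comp (D x)).IsInvertible := by
    have h1 := hA.continuousAt.eventually_mem
      (show _ ∈ 𝓝 (L'.comp (D y)) by
        rw [hA0]; exact ContinuousLinearEquiv.nhds (ContinuousLinearEquiv.refl ℝ E))
    exact h1
  refine (hinv.clm_apply (L'.differentiableAt.comp y hW)).congr_of_eventuallyEq ?_
  filter_upwards [hY, hev] with x hx hi
  have h1 := DFunLike.congr_fun hi.inverse_comp_self (Y x)
  rw [Function.comp_apply, ← hx]
  exact h1.symm

end LeftInverse

/-! ### Submanifolds of the tangent bundle in a chart -/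

section Submanifold

open Filter Topology

variable {n d : ℕ} {M : Type*} [TopologicalSpace M] [ChartedSpace (Eu n) M] [IsManifold (𝓡 n) ∞ M]
  {S : Set (TangentBundle (𝓡 n) M)} [ChartedSpace (Eu d) S]

/-- The differential at `q` of the inclusion of `S`, followed by the chart of `TM` at `v`. -/
def inclDeriv (v : TangentBundle (𝓡 n) M) (q : S) : TangentSpace (𝓡 d) q →L[ℝ] Eu n × Eu n :=
  (tangentChartDeriv v q.1).comp
    (mfderiv (𝓡 d) (𝓡 n).tangent (Subtype.val : S → TangentBundle (𝓡 n) M) q)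

variable {v : TangentBundle (𝓡 n) M} {q : S}

theorem sasakiOn_eq_sasakiForm (g : LorentzianMetric n M)
    (hq : q.1.proj ∈ (extChartAt (𝓡 n) v.proj).source) (ξ η : TangentSpace (𝓡 d) q) :
    sasakiOn g q ξ η = sasakiForm (metricInChart g.val v.proj)
      (extChartAt (𝓡 n).tangent v q.1) (inclDeriv v q ξ) (inclDeriv v q η) :=
  sasaki_eq_sasakiForm g hq _ _

theorem injective_tangentChartDeriv {w : TangentBundle (𝓡 n) M}
    (hw : w.proj ∈ (extChartAt (𝓡 n) v.proj).source) :
    Function.Injective (tangentChartDeriv v w) := by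
  have : IsManifold (𝓡 n) (1 + 1) M :=
    IsManifold.of_le (n := ∞) (by
      rw [one_add_one_eq_two]
      exact WithTop.coe_le_coe.2 (le_top : (2 : ℕ∞) ≤ ⊤))
  refine (isInvertible_mfderiv_extChartAt (I := (𝓡 n).tangent) (x := v) (y := w) ?_).injective
  rw [extChartAt_tangent_source]
  exact hw

theorem injective_inclDeriv (hS : IsEmbeddedSubmanifold d S)
    (hq : q.1.proj ∈ (extChartAt (𝓡 n) v.proj).source) : Function.Injective (inclDeriv (d := d) v q) :=
  (injective_tangentChartDeriv hq).comp (hS.2 q)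

theorem contMDiffAt_chart_incl (hS : IsEmbeddedSubmanifold d S)
    (hq : q.1.proj ∈ (extChartAt (𝓡 n) v.proj).source) :
    ContMDiffAt (𝓡 d) 𝓘(ℝ, Eu n × Eu n) ∞ (extChartAt (𝓡 n).tangent v ∘ Subtype.val) q :=
  (contMDiffAt_chart_tangent hq).comp q hS.1.contMDiffAt

theorem hasMFDerivAt_chart_incl (hS : IsEmbeddedSubmanifold d S)
    (hq : q.1.proj ∈ (extChartAt (𝓡 n) v.proj).source) :
    HasMFDerivAt (𝓡 d) 𝓘(ℝ, Eu n × Eu n) (extChartAt (𝓡 n).tangent v ∘ Subtype.val) q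
      (inclDeriv v q) :=
  ((contMDiffAt_chart_tangent hq).mdifferentiableAt (by simp)).hasMFDerivAt.comp q
    (hS.1.contMDiffAt.mdifferentiableAt (by simp)).hasMFDerivAt

theorem inclDeriv_fst (hS : IsEmbeddedSubmanifold d S)
    (hq : q.1.proj ∈ (extChartAt (𝓡 n) v.proj).source) (u : TangentSpace (𝓡 d) q) :
    (inclDeriv v q u).1 = chartDeriv v.proj q.1.proj (mfderiv (𝓡 d) (𝓡 n) (projOn S) q u) := by
  have hproj : MDifferentiableAt (𝓡 n).tangent (𝓡 n)
      (fun x : TangentBundle (𝓡 n) M => x.proj) q.1 :=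
    (Bundle.contMDiffAt_proj (n := 1) (TangentSpace (𝓡 n) (M := M))).mdifferentiableAt (by simp)
  have h := mfderiv_comp q hproj (hS.1.contMDiffAt.mdifferentiableAt (by simp))
  have h2 := DFunLike.congr_fun h u
  exact (tangentChartDeriv_fst hq _).trans (congrArg (chartDeriv v.proj q.1.proj) h2.symm)

theorem mem_vertical_iff (hS : IsEmbeddedSubmanifold d S)
    (hq : q.1.proj ∈ (extChartAt (𝓡 n) v.proj).source) (u : TangentSpace (𝓡 d) q) :
    u ∈ vertical (n := n) (projOn S) q ↔ (inclDeriv v q u).1 = 0 := by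
  rw [inclDeriv_fst hS hq]
  refine Iff.trans ?_ (map_eq_zero_iff _ (isInvertible_chartDeriv hq).injective).symm
  exact LinearMap.mem_ker

end Submanifold

/-! ### Tangent spaces of the null congruence -/

section Congruence

open Filter Topology

variable {n : ℕ} {M : Type*} [TopologicalSpace M] [ChartedSpace (Eu n) M] [IsManifold (𝓡 n) ∞ M]
  {g : LorentzianMetric n M} {K : Π p : M, TangentSpace (𝓡 n) p}

theorem mem_nullCongruence_iff {v w : TangentBundle (𝓡 n) M}
    (hw : w.proj ∈ (extChartAt (𝓡 n) v.proj).source) :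
    w ∈ nullCongruence g K ↔ congruenceFun (metricInChart g.val v.proj) (fieldInChart K v.proj)
      (extChartAt (𝓡 n).tangent v w) = (0, -1) := by
  rw [extChartAt_tangent v w hw, congruenceFun, Prod.mk.injEq]
  dsimp only
  rw [fieldInChart_apply _ hw, metricInChart_apply _ hw, metricInChart_apply _ hw]
  rfl

variable {v : TangentBundle (𝓡 n) M} {q : nullCongruence g K}
  [ChartedSpace (Eu (2 * (n - 1))) (nullCongruence g K)]

/-- The tangent spaces of the null congruence, in coordinates. -/
theorem range_inclDeriv
    (hK : ContMDiff (𝓡 n) (𝓡 n).tangent ∞ (fun p => (⟨p, K p⟩ : TangentBundle (𝓡 n) M)))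
    (hS : IsEmbeddedSubmanifold (2 * (n - 1)) (nullCongruence g K))
    (hq : q.1.proj ∈ (extChartAt (𝓡 n) v.proj).source) (W : Eu n × Eu n) :
    fderiv ℝ (congruenceFun (metricInChart g.val v.proj) (fieldInChart K v.proj))
      (extChartAt (𝓡 n).tangent v q.1) W = 0 ↔ ∃ u : TangentSpace (𝓡 (2 * (n - 1))) q, inclDeriv v q u = W := by
  set F := congruenceFun (metricInChart g.val v.proj) (fieldInChart K v.proj) with hF
  set x := extChartAt (𝓡 n).tangent v q.1 with hx
  have hx1 : x.1 ∈ (extChartAt (𝓡 n) v.proj).target := by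
    rw [hx, extChartAt_tangent _ _ hq]
    exact (extChartAt (𝓡 n) v.proj).map_source hq
  have hd := contDiffAt_metricInChart g hx1
  have hk := contDiffAt_fieldInChart hx1 hK.contMDiffAt
  have hFx : F x = (0, -1) := (mem_nullCongruence_iff hq).1 q.2
  have hsurj := surjective_fderiv_congruenceFun hd hk (isInvertible_metricInChart g hx1)
    (Eventually.of_forall fun y => metricInChart_symm g v.proj y) hFx
  have hFd : DifferentiableAt ℝ F x := (contDiffAt_congruenceFun hd hk).differentiableAt (by simp)
  have hcomp := (hFd.hasFDerivAt.hasMFDerivAt.comp q (hasMFDerivAt_chart_incl hS hq)).mfderiv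
  have he : F ∘ (extChartAt (𝓡 n).tangent v ∘ Subtype.val) =ᶠ[𝓝 q] fun _ => (0, -1) := by
    filter_upwards [continuous_subtype_val.continuousAt.eventually
      (eventually_proj_mem_source hq)] with u hu
    exact (mem_nullCongruence_iff hu).1 u.2
  rw [he.mfderiv_eq, mfderiv_const] at hcomp
  have hle : LinearMap.range (inclDeriv (d := 2 * (n - 1)) v q : TangentSpace (𝓡 (2 * (n - 1))) q →ₗ[ℝ] Eu n × Eu n) ≤
      LinearMap.ker (fderiv ℝ F x : Eu n × Eu n →ₗ[ℝ] ℝ × ℝ) := by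
    rintro _ ⟨u, rfl⟩
    exact (DFunLike.congr_fun hcomp u).symm
  have hr := (fderiv ℝ F x : Eu n × Eu n →ₗ[ℝ] ℝ × ℝ).finrank_range_add_finrank_ker
  rw [LinearMap.range_eq_top.2 hsurj, finrank_top] at hr
  have hr2 : Module.finrank ℝ (LinearMap.range
      (inclDeriv (d := 2 * (n - 1)) v q : TangentSpace (𝓡 (2 * (n - 1))) q →ₗ[ℝ] Eu n × Eu n)) = 2 * (n - 1) := by
    rw [LinearMap.finrank_range_of_inj (injective_inclDeriv (d := 2 * (n - 1)) hS hq)]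
    exact finrank_euclideanSpace_fin
  -- The kernel has dimension `2n - 2` because the differential maps onto a plane. The rank equation
  -- itself excludes `n = 0`, so the truncated subtraction is harmless.
  have heq := Submodule.eq_of_le_of_finrank_eq hle (by
    simp only [Module.finrank_prod, finrank_euclideanSpace_fin, Module.finrank_self] at hr
    omega)
  exact LinearMap.mem_ker.symm.trans ((SetLike.ext_iff.1 heq W).symm.trans LinearMap.mem_range)

/-- The kernel description of `range_inclDeriv` in the shape expected by the linear algebra of the
splitting. The letters are variables bound by equations so that each use supplies them by `rfl`. -/
theorem exists_inclDeriv_iff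
    (hK : ContMDiff (𝓡 n) (𝓡 n).tangent ∞ (fun p => (⟨p, K p⟩ : TangentBundle (𝓡 n) M)))
    (hS : IsEmbeddedSubmanifold (2 * (n - 1)) (nullCongruence g K))
    (hq : q.1.proj ∈ (extChartAt (𝓡 n) v.proj).source) {x a k : Eu n}
    {h : Eu n → (Eu n →L[ℝ] Eu n →L[ℝ] ℝ)} {Γ : Eu n →L[ℝ] Eu n} {l : Eu n →L[ℝ] ℝ}
    (hx : x = (extChartAt (𝓡 n).tangent v q.1).1) (ha : a = (extChartAt (𝓡 n).tangent v q.1).2)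
    (hh : h = metricInChart g.val v.proj) (hk : k = fieldInChart K v.proj x)
    (hΓ : Γ = (christoffel h x).flip a)
    (hl : l = (h x a).comp (fderiv ℝ (fieldInChart K v.proj) x + (christoffel h x).flip k))
    (W : Eu n × Eu n) :
    h x (W.2 + Γ W.1) a = 0 ∧ h x (W.2 + Γ W.1) k = - l W.1 ↔
      ∃ u : TangentSpace (𝓡 (2 * (n - 1))) q, inclDeriv v q u = W := by
  have hx1 : (extChartAt (𝓡 n).tangent v q.1).1 ∈ (extChartAt (𝓡 n) v.proj).target := by
    rw [extChartAt_tangent _ _ hq]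
    exact (extChartAt (𝓡 n) v.proj).map_source hq
  rw [← range_inclDeriv hK hS hq, fderiv_congruenceFun (contDiffAt_metricInChart g hx1)
    (contDiffAt_fieldInChart hx1 hK.contMDiffAt) (isInvertible_metricInChart g hx1)
    (Eventually.of_forall fun y => metricInChart_symm g v.proj y), Prod.mk_eq_zero]
  rw [← hx, ← ha, ← hh, ← hk, hΓ, hl]
  refine and_congr ?_ ?_
  · rw [mul_eq_zero, or_iff_right two_ne_zero]
    rfl
  · rw [eq_neg_iff_add_eq_zero]
    rfl

end Congruence

/-! ### Vertical and horizontal projections on the null congruence -/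

section Decomposition

open Filter Topology

variable {n : ℕ} {M : Type*} [TopologicalSpace M] [ChartedSpace (Eu n) M] [IsManifold (𝓡 n) ∞ M]
  {g : LorentzianMetric n M} {K : Π p : M, TangentSpace (𝓡 n) p}
  {v : TangentBundle (𝓡 n) M} {q : nullCongruence g K}
  [ChartedSpace (Eu (2 * (n - 1))) (nullCongruence g K)]

/-- The vertical part, in coordinates, of a tangent vector of the null congruence with coordinates
`W` at the point with coordinates `x`. -/
def verticalCoord (h : Eu n → (Eu n →L[ℝ] Eu n →L[ℝ] ℝ)) (k : Eu n → Eu n) (x W : Eu n × Eu n) :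
    Eu n × Eu n :=
  (0, orthProj (h x.1) x.2 (k x.1) (W.2 + christoffel h x.1 W.1 x.2))

/-- Projecting the connector of `e` to the orthogonal of `a` and `k` gives its vertical part
explicitly in coordinates. This gives both the decomposition and, later, differentiability of the
vertical projection of a field. -/
theorem exists_vertical_horizontal
    (hK : ContMDiff (𝓡 n) (𝓡 n).tangent ∞ (fun p => (⟨p, K p⟩ : TangentBundle (𝓡 n) M)))
    (hS : IsEmbeddedSubmanifold (2 * (n - 1)) (nullCongruence g K))
    (hq : q.1.proj ∈ (extChartAt (𝓡 n) v.proj).source) (e : TangentSpace (𝓡 (2 * (n - 1))) q) :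
    ∃ u ∈ vertical (n := n) (projOn (nullCongruence g K)) q,
      inclDeriv v q u = verticalCoord (metricInChart g.val v.proj) (fieldInChart K v.proj)
        (extChartAt (𝓡 n).tangent v q.1) (inclDeriv v q e) ∧
      e - u ∈ horizontal (n := n) (sasakiOn g) (projOn (nullCongruence g K)) q := by
  have hF := (mem_nullCongruence_iff hq).1 q.2
  have hJ := exists_inclDeriv_iff hK hS hq rfl rfl rfl rfl rfl rfl
  obtain ⟨u, hu⟩ := exists_vertical_part (J := (inclDeriv v q).toLinearMap)
    (metricInChart_symm g v.proj _) (congrArg Prod.fst hF) (congrArg Prod.snd hF)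
    (fun W => (hJ W).1) ((inclDeriv v q e).2 + christoffel (metricInChart g.val v.proj)
      (extChartAt (𝓡 n).tangent v q.1).1 (inclDeriv v q e).1 (extChartAt (𝓡 n).tangent v q.1).2)
  change inclDeriv v q u = _ at hu
  refine ⟨u, (mem_vertical_iff hS hq u).2 (by rw [hu]), hu, fun b hb => ?_⟩
  have hb1 := (mem_vertical_iff hS hq b).1 hb
  have hb2 := (hJ (inclDeriv v q b)).2 ⟨b, rfl⟩
  simp only [hb1, map_zero, add_zero, neg_zero] at hb2
  rw [map_sub, sub_eq_zero, sasakiOn_eq_sasakiForm g hq, sasakiOn_eq_sasakiForm g hq,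
    sasakiForm_apply, sasakiForm_apply, hb1, hu]
  simp only [map_zero, zero_apply, zero_add, add_zero]
  exact (orthProj_inner _ hb2.1 hb2.2).symm

theorem connector_of_mem_horizontal
    (hK : ContMDiff (𝓡 n) (𝓡 n).tangent ∞ (fun p => (⟨p, K p⟩ : TangentBundle (𝓡 n) M)))
    (hS : IsEmbeddedSubmanifold (2 * (n - 1)) (nullCongruence g K))
    (hq : q.1.proj ∈ (extChartAt (𝓡 n) v.proj).source) {e : TangentSpace (𝓡 (2 * (n - 1))) q}
    (he : e ∈ horizontal (n := n) (sasakiOn g) (projOn (nullCongruence g K)) q)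
    {x a : Eu n} (hx : x = (extChartAt (𝓡 n).tangent v q.1).1)
    (ha : a = (extChartAt (𝓡 n).tangent v q.1).2) :
    (inclDeriv v q e).2 + christoffel (metricInChart g.val v.proj) x (inclDeriv v q e).1 a =
      metricInChart g.val v.proj x a (fderiv ℝ (fieldInChart K v.proj) x (inclDeriv v q e).1 +
        christoffel (metricInChart g.val v.proj) x (inclDeriv v q e).1
          (fieldInChart K v.proj x)) • a := by
  have hx1 : (extChartAt (𝓡 n).tangent v q.1).1 ∈ (extChartAt (𝓡 n) v.proj).target := by
    rw [extChartAt_tangent _ _ hq]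
    exact (extChartAt (𝓡 n) v.proj).map_source hq
  have hF := (mem_nullCongruence_iff hq).1 q.2
  subst hx ha
  refine connector_of_horizontal (J := (inclDeriv v q).toLinearMap)
    (metricInChart_symm g v.proj _) (congrArg Prod.fst hF) (congrArg Prod.snd hF)
    (fun u hu => (isInvertible_metricInChart g hx1).injective (by ext w; simpa using hu w))
    (exists_inclDeriv_iff hK hS hq rfl rfl rfl rfl rfl rfl) fun u hu => ?_
  change (inclDeriv v q u).1 = 0 at hu
  have h := he u ((mem_vertical_iff hS hq u).2 hu)
  rw [sasakiOn_eq_sasakiForm g hq, sasakiForm_apply, hu] at h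
  simp only [map_zero, zero_apply, zero_add, add_zero] at h
  exact h

theorem eq_zero_of_sasakiOn
    (hK : ContMDiff (𝓡 n) (𝓡 n).tangent ∞ (fun p => (⟨p, K p⟩ : TangentBundle (𝓡 n) M)))
    (hS : IsEmbeddedSubmanifold (2 * (n - 1)) (nullCongruence g K))
    {e : TangentSpace (𝓡 (2 * (n - 1))) q} (he : ∀ u, sasakiOn g q e u = 0) : e = 0 := by
  have hq : q.1.proj ∈ (extChartAt (𝓡 n) q.1.proj).source := mem_extChartAt_source _
  have hx1 : (extChartAt (𝓡 n).tangent q.1 q.1).1 ∈ (extChartAt (𝓡 n) q.1.proj).target := by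
    rw [extChartAt_tangent _ _ hq]
    exact (extChartAt (𝓡 n) q.1.proj).map_source hq
  have hF := (mem_nullCongruence_iff hq).1 q.2
  refine eq_zero_of_forall_orthogonal (J := (inclDeriv q.1 q).toLinearMap)
    (metricInChart_symm g q.1.proj _) (congrArg Prod.fst hF) (congrArg Prod.snd hF)
    (fun u hu => (isInvertible_metricInChart g hx1).injective (by ext w; simpa using hu w))
    (injective_inclDeriv hS hq) (exists_inclDeriv_iff hK hS hq rfl rfl rfl rfl rfl rfl)
    fun u => ?_
  have h := he u
  rw [sasakiOn_eq_sasakiForm g hq, sasakiForm_apply] at h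
  exact h

/-- The sum is everything by `exists_vertical_horizontal`. A vector in the intersection is
orthogonal to both parts of every vector, so it vanishes by nondegeneracy. Hence `vertProj` and
`horProj` never take their default value. -/
theorem isCompl_vertical_horizontal
    (hK : ContMDiff (𝓡 n) (𝓡 n).tangent ∞ (fun p => (⟨p, K p⟩ : TangentBundle (𝓡 n) M)))
    (hS : IsEmbeddedSubmanifold (2 * (n - 1)) (nullCongruence g K)) (q : nullCongruence g K) :
    IsCompl (vertical (m := 2 * (n - 1)) (n := n) (projOn (nullCongruence g K)) q)
      (horizontal (n := n) (sasakiOn g) (projOn (nullCongruence g K)) q) := by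
  have hq : q.1.proj ∈ (extChartAt (𝓡 n) q.1.proj).source := mem_extChartAt_source _
  refine IsCompl.of_eq ?_ ?_
  · refine (Submodule.eq_bot_iff _).2 fun e he => eq_zero_of_sasakiOn hK hS fun u => ?_
    obtain ⟨b, hb, -, hub⟩ := exists_vertical_horizontal hK hS hq u
    have h1 := hub e he.1
    have h2 := he.2 b hb
    have hsymm : sasakiOn g q e b = sasakiOn g q b e := by
      rw [sasakiOn_eq_sasakiForm g hq, sasakiOn_eq_sasakiForm g hq, sasakiForm_apply,
        sasakiForm_apply, metricInChart_symm, metricInChart_symm g _ _ (_ + _)]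
    rwa [map_sub, hsymm, h2, sub_zero] at h1
  · refine (Submodule.eq_top_iff').2 fun e => ?_
    obtain ⟨b, hb, -, hub⟩ := exists_vertical_horizontal hK hS hq e
    exact Submodule.mem_sup.2 ⟨b, hb, e - b, hub, add_sub_cancel _ _⟩

theorem vertProj_of_mem
    (hK : ContMDiff (𝓡 n) (𝓡 n).tangent ∞ (fun p => (⟨p, K p⟩ : TangentBundle (𝓡 n) M)))
    (hS : IsEmbeddedSubmanifold (2 * (n - 1)) (nullCongruence g K))
    {e : TangentSpace (𝓡 (2 * (n - 1))) q}
    (he : e ∈ vertical (n := n) (projOn (nullCongruence g K)) q) :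
    vertProj (n := n) (sasakiOn g) (projOn (nullCongruence g K)) q e = e := by
  rw [vertProj, dif_pos (isCompl_vertical_horizontal hK hS q)]
  exact Submodule.projection_apply_of_mem_left _ he

theorem inclDeriv_vertProj
    (hK : ContMDiff (𝓡 n) (𝓡 n).tangent ∞ (fun p => (⟨p, K p⟩ : TangentBundle (𝓡 n) M)))
    (hS : IsEmbeddedSubmanifold (2 * (n - 1)) (nullCongruence g K))
    (hq : q.1.proj ∈ (extChartAt (𝓡 n) v.proj).source) (e : TangentSpace (𝓡 (2 * (n - 1))) q) :
    inclDeriv v q (vertProj (n := n) (sasakiOn g) (projOn (nullCongruence g K)) q e) =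
      verticalCoord (metricInChart g.val v.proj) (fieldInChart K v.proj)
        (extChartAt (𝓡 n).tangent v q.1) (inclDeriv v q e) := by
  obtain ⟨u, hu, huJ, hue⟩ := exists_vertical_horizontal hK hS hq e
  rw [← huJ, vertProj, dif_pos (isCompl_vertical_horizontal hK hS q)]
  congr 1
  have h := (Submodule.projection_apply_eq_zero_iff (isCompl_vertical_horizontal hK hS q)).2 hue
  rw [map_sub, Submodule.projection_apply_of_mem_left _ hu, sub_eq_zero] at h
  exact h

/-- Pairing with a horizontal vector only sees the first term of O'Neill's tensor. -/
theorem sasakiOn_horProj_add_vertProj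
    (hK : ContMDiff (𝓡 n) (𝓡 n).tangent ∞ (fun p => (⟨p, K p⟩ : TangentBundle (𝓡 n) M)))
    (hS : IsEmbeddedSubmanifold (2 * (n - 1)) (nullCongruence g K))
    {Z : TangentSpace (𝓡 (2 * (n - 1))) q}
    (hZ : Z ∈ horizontal (n := n) (sasakiOn g) (projOn (nullCongruence g K)) q)
    (e e' : TangentSpace (𝓡 (2 * (n - 1))) q) :
    sasakiOn g q (horProj (n := n) (sasakiOn g) (projOn (nullCongruence g K)) q e +
      vertProj (n := n) (sasakiOn g) (projOn (nullCongruence g K)) q e') Z = sasakiOn g q e Z := by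
  have hc := isCompl_vertical_horizontal hK hS q
  rw [horProj, vertProj, dif_pos hc, dif_pos hc, map_add, add_apply,
    hZ _ (Submodule.projection_apply_mem hc e'), add_zero]
  conv_rhs => rw [← Submodule.projection_add_projection_eq_self hc e, map_add, add_apply,
    hZ _ (Submodule.projection_apply_mem hc e), zero_add]

end Decomposition

/-! ### Covariant derivatives and the inclusion in charts -/

section ONeill

open Filter Topology

/-- Pairing with `w` replaces the second-kind Christoffel symbols by the first-kind ones, which pull
back along the inclusion. -/
theorem leviCivita_apply {m : ℕ} {N : Type*} [TopologicalSpace N] [ChartedSpace (Eu m) N]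
    [IsManifold (𝓡 m) ∞ N]
    (h : Π q : N, TangentSpace (𝓡 m) q →L[ℝ] TangentSpace (𝓡 m) q →L[ℝ] ℝ)
    (Y : Π q : N, TangentSpace (𝓡 m) q) {p : N}
    (hi : (metricInChart h p (extChartAt (𝓡 m) p p)).IsInvertible) (z w : TangentSpace (𝓡 m) p) :
    h p (leviCivita h Y p z) w =
      metricInChart h p (extChartAt (𝓡 m) p p)
        (fderiv ℝ (fieldInChart Y p) (extChartAt (𝓡 m) p p) (chartDeriv p p z))
        (chartDeriv p p w) +
      christoffelFirst (metricInChart h p) (extChartAt (𝓡 m) p p) (chartDeriv p p z)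
        (chartDeriv p p (Y p)) (chartDeriv p p w) := by
  have hp := mem_extChartAt_source (I := 𝓡 m) p
  rw [← christoffel_spec _ _ _ _ _ hi, ← metricInChart_apply h hp, ← add_apply, ← map_add,
    ← fieldInChart_apply Y hp]
  congr 2
  exact DFunLike.congr_fun (isInvertible_chartDeriv hp).self_comp_inverse _

theorem chartDeriv_leviCivita {m : ℕ} {N : Type*} [TopologicalSpace N] [ChartedSpace (Eu m) N]
    [IsManifold (𝓡 m) ∞ N]
    (h : Π q : N, TangentSpace (𝓡 m) q →L[ℝ] TangentSpace (𝓡 m) q →L[ℝ] ℝ)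
    (Y : Π q : N, TangentSpace (𝓡 m) q) (p : N) (z : TangentSpace (𝓡 m) p) :
    chartDeriv p p (leviCivita h Y p z) =
      fderiv ℝ (fieldInChart Y p) (extChartAt (𝓡 m) p p) (chartDeriv p p z) +
        christoffel (metricInChart h p) (extChartAt (𝓡 m) p p) (chartDeriv p p z)
          (fieldInChart Y p (extChartAt (𝓡 m) p p)) :=
  DFunLike.congr_fun
    (isInvertible_chartDeriv (mem_extChartAt_source (I := 𝓡 m) p)).self_comp_inverse _

theorem differentiableAt_verticalCoord {n d : ℕ} {h : Eu n → (Eu n →L[ℝ] Eu n →L[ℝ] ℝ)}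
    {k : Eu n → Eu n} {x W : Eu d → Eu n × Eu n} {y : Eu d} (hd : ContDiffAt ℝ ∞ h (x y).1)
    (hi : (h (x y).1).IsInvertible) (hk : ContDiffAt ℝ ∞ k (x y).1)
    (hx : DifferentiableAt ℝ x y) (hW : DifferentiableAt ℝ W y) :
    DifferentiableAt ℝ (fun z => verticalCoord h k (x z) (W z)) y := by
  have h1 : DifferentiableAt ℝ (fun z => h (x z).1) y :=
    (hd.differentiableAt (by simp)).comp (f := fun z => (x z).1) y hx.fst
  have h2 : DifferentiableAt ℝ (fun z => k (x z).1) y :=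
    (hk.differentiableAt (by simp)).comp (f := fun z => (x z).1) y hx.fst
  have h3 : DifferentiableAt ℝ (fun z => christoffel h (x z).1) y :=
    ((contDiffAt_christoffel hd hi).differentiableAt (by simp)).comp (f := fun z => (x z).1) y hx.fst
  have h4 : DifferentiableAt ℝ (fun z => (W z).2 + christoffel h (x z).1 (W z).1 (x z).2) y :=
    hW.snd.add ((h3.clm_apply hW.fst).clm_apply hx.snd)
  have h5 : ∀ {a b : Eu d → Eu n}, DifferentiableAt ℝ a y → DifferentiableAt ℝ b y →
      DifferentiableAt ℝ (fun z => h (x z).1 (a z) (b z)) y := fun ha hb =>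
    (h1.clm_apply ha).clm_apply hb
  exact (differentiableAt_const _).prodMk
    ((h4.add (((h5 h4 h2).add ((h5 h4 hx.snd).mul (h5 h2 h2))).smul hx.snd)).add
      ((h5 h4 hx.snd).smul h2))

variable {n : ℕ} {M : Type*} [TopologicalSpace M] [ChartedSpace (Eu n) M] [IsManifold (𝓡 n) ∞ M]
  {d : ℕ} {S : Set (TangentBundle (𝓡 n) M)} [ChartedSpace (Eu d) S] [IsManifold (𝓡 d) ∞ S]

/-- The inclusion of `S` in `TM`, read in the charts of `S` and `TM` at `v`. -/
def inclInChart (d : ℕ) [ChartedSpace (Eu d) S] (v : S) : Eu d → Eu n × Eu n :=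
  (extChartAt (𝓡 n).tangent v.1 ∘ Subtype.val) ∘ (extChartAt (𝓡 d) v).symm

theorem contDiffAt_inclInChart (hS : IsEmbeddedSubmanifold d S) {v : S} {y : Eu d}
    (hy : y ∈ (extChartAt (𝓡 d) v).target)
    (hq : ((extChartAt (𝓡 d) v).symm y).1.proj ∈ (extChartAt (𝓡 n) v.1.proj).source) :
    ContDiffAt ℝ ∞ (inclInChart d v) y :=
  ((contMDiffAt_chart_incl hS hq).comp y (contMDiffAt_chart_symm hy)).contDiffAt

theorem fderiv_inclInChart (hS : IsEmbeddedSubmanifold d S) {v : S} {y : Eu d}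
    (hy : y ∈ (extChartAt (𝓡 d) v).target)
    (hq : ((extChartAt (𝓡 d) v).symm y).1.proj ∈ (extChartAt (𝓡 n) v.1.proj).source) (u : Eu d) :
    fderiv ℝ (inclInChart d v) y u =
      inclDeriv v.1 ((extChartAt (𝓡 d) v).symm y) (chartSymmDeriv v y u) := by
  have h := ((hasMFDerivAt_chart_incl hS hq).comp y
    ((contMDiffAt_chart_symm hy).mdifferentiableAt (by simp)).hasMFDerivAt).mfderiv
  rw [← mfderiv_eq_fderiv]
  exact DFunLike.congr_fun h u

theorem metricInChart_sasakiOn (g : LorentzianMetric n M) (hS : IsEmbeddedSubmanifold d S) {v : S}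
    {y : Eu d} (hy : y ∈ (extChartAt (𝓡 d) v).target)
    (hq : ((extChartAt (𝓡 d) v).symm y).1.proj ∈ (extChartAt (𝓡 n) v.1.proj).source) :
    metricInChart (sasakiOn g) v y = pullbackForm (fderiv ℝ (inclInChart d v) y)
      (sasakiForm (metricInChart g.val v.1.proj) (inclInChart d v y)) := by
  ext u w
  have hι : inclInChart d v y = extChartAt (𝓡 n).tangent v.1 ((extChartAt (𝓡 d) v).symm y).1 := rfl
  rw [pullbackForm_apply, fderiv_inclInChart hS hy hq, fderiv_inclInChart hS hy hq, metricInChart,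
    pullbackForm_apply, sasakiOn_eq_sasakiForm g hq, hι]

theorem eventually_inclInChart (v : S) :
    ∀ᶠ y in 𝓝 (extChartAt (𝓡 d) v v), y ∈ (extChartAt (𝓡 d) v).target ∧
      ((extChartAt (𝓡 d) v).symm y).1.proj ∈ (extChartAt (𝓡 n) v.1.proj).source := by
  have hv := mem_extChartAt_target (I := 𝓡 d) v
  refine ((isOpen_extChartAt_target v).eventually_mem hv).and ?_
  refine (contMDiffAt_chart_symm hv).continuousAt.eventually
    (p := fun q : S => q.1.proj ∈ (extChartAt (𝓡 n) v.1.proj).source) ?_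
  rw [(extChartAt (𝓡 d) v).left_inv (mem_extChartAt_source v)]
  exact continuous_subtype_val.continuousAt.eventually
    (eventually_proj_mem_source (mem_extChartAt_source v.1.proj))

theorem fderiv_inclInChart_fieldInChart (hS : IsEmbeddedSubmanifold d S) {v : S} {y : Eu d}
    (hy : y ∈ (extChartAt (𝓡 d) v).target)
    (hq : ((extChartAt (𝓡 d) v).symm y).1.proj ∈ (extChartAt (𝓡 n) v.1.proj).source)
    (Y : Π q : S, TangentSpace (𝓡 d) q) :
    fderiv ℝ (inclInChart d v) y (fieldInChart Y v y) =
      inclDeriv v.1 ((extChartAt (𝓡 d) v).symm y) (Y ((extChartAt (𝓡 d) v).symm y)) := by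
  rw [fderiv_inclInChart hS hy hq, fieldInChart, chartSymmDeriv_chartDeriv hy]

theorem fderiv_inclInChart_chartDeriv (hS : IsEmbeddedSubmanifold d S) (v : S)
    (u : TangentSpace (𝓡 d) v) :
    fderiv ℝ (inclInChart d v) (extChartAt (𝓡 d) v v) (chartDeriv v v u) = inclDeriv v.1 v u := by
  have hv := mem_extChartAt_source (I := 𝓡 d) v
  have h := (((hasMFDerivAt_chart_incl hS (mem_extChartAt_source (I := 𝓡 n) v.1.proj)))).mfderiv
  have hc : HasMFDerivAt (𝓡 d) 𝓘(ℝ, Eu n × Eu n) (inclInChart d v ∘ extChartAt (𝓡 d) v) v _ :=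
    ((contDiffAt_inclInChart hS (eventually_inclInChart v).self_of_nhds.1
      (eventually_inclInChart v).self_of_nhds.2).differentiableAt
      (by simp)).hasFDerivAt.hasMFDerivAt.comp v
      ((contMDiffAt_chart hv).mdifferentiableAt (by simp)).hasMFDerivAt
  have he : inclInChart d v ∘ extChartAt (𝓡 d) v =ᶠ[𝓝 v]
      (extChartAt (𝓡 n).tangent v.1 ∘ Subtype.val) := by
    filter_upwards [(isOpen_extChartAt_source v).mem_nhds hv] with q hq
    rw [Function.comp_apply, inclInChart, Function.comp_apply, (extChartAt (𝓡 d) v).left_inv hq]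
  exact DFunLike.congr_fun (hc.mfderiv.symm.trans (he.mfderiv_eq.trans h)) u

end ONeill

/-! ### The formula for the O'Neill tensor -/

section ONeillFormula

open Filter Topology

variable {n : ℕ} {M : Type*} [TopologicalSpace M] [ChartedSpace (Eu n) M] [IsManifold (𝓡 n) ∞ M]
  {g : LorentzianMetric n M} {K : Π p : M, TangentSpace (𝓡 n) p}
  [ChartedSpace (Eu (2 * (n - 1))) (nullCongruence g K)]
  [IsManifold (𝓡 (2 * (n - 1))) ∞ (nullCongruence g K)]

theorem sasakiOn_oneillT
    (hK : ContMDiff (𝓡 n) (𝓡 n).tangent ∞ (fun p => (⟨p, K p⟩ : TangentBundle (𝓡 n) M)))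
    (hS : IsEmbeddedSubmanifold (2 * (n - 1)) (nullCongruence g K))
    (v : nullCongruence g K) (ξ ζ Z : TangentSpace (𝓡 (2 * (n - 1))) v)
    (hξ : ξ ∈ vertical (n := n) (projOn (nullCongruence g K)) v)
    (hζ : ζ ∈ vertical (n := n) (projOn (nullCongruence g K)) v)
    (hZ : Z ∈ horizontal (n := n) (sasakiOn g) (projOn (nullCongruence g K)) v)
    (E₁ E₂ : Π w : nullCongruence g K, TangentSpace (𝓡 (2 * (n - 1))) w)
    (hE₁ : IsSmoothExtension v ξ E₁) (hE₂ : IsSmoothExtension v ζ E₂) :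
    sasakiOn g v (oneillT (n := n) (sasakiOn g) (projOn (nullCongruence g K)) E₁ E₂ v) Z =
      - g.val v.1.proj v.1.2 (leviCivita g.val K v.1.proj
          (mfderiv (𝓡 (2 * (n - 1))) (𝓡 n) (projOn (nullCongruence g K)) v Z)) *
        sasakiOn g v ξ ζ := by
  set Y : Π w : nullCongruence g K, TangentSpace (𝓡 (2 * (n - 1))) w :=
    fun x => vertProj (n := n) (sasakiOn g) (projOn (nullCongruence g K)) x (E₂ x) with hYdef
  set y := extChartAt (𝓡 (2 * (n - 1))) v v with hy
  set ι := inclInChart (2 * (n - 1)) v with hι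
  set h := metricInChart g.val v.1.proj with hh
  set k := fieldInChart K v.1.proj with hk
  have hev := eventually_inclInChart (d := 2 * (n - 1)) v
  have hyv : (extChartAt (𝓡 (2 * (n - 1))) v).symm y = v :=
    (extChartAt (𝓡 (2 * (n - 1))) v).left_inv (mem_extChartAt_source v)
  have hvs := mem_extChartAt_source (I := 𝓡 n) v.1.proj
  have hvt := mem_extChartAt_target (I := 𝓡 n) v.1.proj
  have hιy : ι y = (extChartAt (𝓡 n) v.1.proj v.1.proj, chartDeriv v.1.proj v.1.proj v.1.2) := by
    rw [hι, inclInChart, Function.comp_apply, hyv]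
    exact extChartAt_tangent v.1 v.1 hvs
  have hιs : ContDiffAt ℝ ∞ ι y :=
    contDiffAt_inclInChart hS hev.self_of_nhds.1 hev.self_of_nhds.2
  have hx1 : (ι y).1 = extChartAt (𝓡 n) v.1.proj v.1.proj := by rw [hιy]
  have hx2 : (ι y).2 = chartDeriv v.1.proj v.1.proj v.1.2 := by rw [hιy]
  have hxt : (ι y).1 ∈ (extChartAt (𝓡 n) v.1.proj).target := by rw [hx1]; exact hvt
  have hιv : ι y = extChartAt (𝓡 n).tangent v.1 v.1 := by
    rw [hιy]; exact (extChartAt_tangent v.1 v.1 hvs).symm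
  have hd : ContDiffAt ℝ ∞ h (ι y).1 := contDiffAt_metricInChart g hxt
  have hi : (h (ι y).1).IsInvertible := isInvertible_metricInChart g hxt
  have hkd : ContDiffAt ℝ ∞ k (ι y).1 := contDiffAt_fieldInChart hxt hK.contMDiffAt
  have hG : ∀ᶠ z in 𝓝 y, metricInChart (sasakiOn g) v z =
      pullbackForm (fderiv ℝ ι z) (sasakiForm h (ι z)) :=
    hev.mono fun z hz => metricInChart_sasakiOn g hS hz.1 hz.2
  have hYι : ∀ᶠ z in 𝓝 y, fderiv ℝ ι z (fieldInChart Y v z) =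
      verticalCoord h k (ι z) (fderiv ℝ ι z (fieldInChart E₂ v z)) := by
    filter_upwards [hev] with z hz
    rw [fderiv_inclInChart_fieldInChart hS hz.1 hz.2, fderiv_inclInChart_fieldInChart hS hz.1 hz.2]
    exact inclDeriv_vertProj hK hS hz.2 _
  have hιd : DifferentiableAt ℝ (fderiv ℝ ι) y :=
    (hιs.fderiv_right (m := ∞) (by simp)).differentiableAt (by simp)
  have hιinj : Function.Injective (fderiv ℝ ι y) := by
    intro u w huw
    rw [hι, fderiv_inclInChart hS hev.self_of_nhds.1 hev.self_of_nhds.2,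
      fderiv_inclInChart hS hev.self_of_nhds.1 hev.self_of_nhds.2] at huw
    have h1 := injective_inclDeriv hS hev.self_of_nhds.2 huw
    rw [← chartDeriv_chartSymmDeriv hev.self_of_nhds.1 u, h1,
      chartDeriv_chartSymmDeriv hev.self_of_nhds.1 w]
  have hEd : DifferentiableAt ℝ (fieldInChart E₂ v) y :=
    (contDiffAt_fieldInChart hev.self_of_nhds.1 (by
      rw [hyv]; exact hE₂.1)).differentiableAt (by simp)
  -- The projected field is defined pointwise by a case distinction, but its image under the
  -- injective differential of `ι` is the explicit expression `verticalCoord`, from which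
  -- differentiability is recovered.
  have hYd : DifferentiableAt ℝ (fieldInChart Y v) y :=
    differentiableAt_of_injective hιd hιinj
      (differentiableAt_verticalCoord hd hi hkd (hιs.differentiableAt (by simp))
        (hιd.clm_apply hEd)) hYι
  have hYv : ∀ᶠ z in 𝓝 y, (fderiv ℝ ι z (fieldInChart Y v z)).1 = 0 :=
    hYι.mono fun z hz => by rw [hz]; rfl
  have hYo : ∀ᶠ z in 𝓝 y, h (ι z).1 (fderiv ℝ ι z (fieldInChart Y v z)).2 (ι z).2 = 0 := by
    filter_upwards [hYι, hev] with z hz hzv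
    have hF := (mem_nullCongruence_iff hzv.2).1 ((extChartAt (𝓡 (2 * (n - 1))) v).symm z).2
    rw [hz]
    exact orthProj_left (metricInChart_symm g v.1.proj _) (congrArg Prod.fst hF)
      (congrArg Prod.snd hF) _
  have hYζ : Y v = ζ := by
    rw [hYdef]
    dsimp only
    rw [hE₂.2, vertProj_of_mem hK hS hζ]
  have hE₁v : vertProj (n := n) (sasakiOn g) (projOn (nullCongruence g K)) v (E₁ v) = ξ := by
    rw [hE₁.2, vertProj_of_mem hK hS hξ]
  have hGi : (metricInChart (sasakiOn g) v y).IsInvertible :=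
    isInvertible_metricInChart_of_nondegenerate hev.self_of_nhds.1
      fun q u => eq_zero_of_sasakiOn hK hS
  have hξ' : (fderiv ℝ ι y (chartDeriv v v ξ)).1 = 0 := by
    rw [hι, hy, fderiv_inclInChart_chartDeriv hS v]
    exact (mem_vertical_iff hS hvs ξ).1 hξ
  have hfield : fieldInChart Y v y = chartDeriv v v ζ := by
    rw [hy, fieldInChart_apply Y (mem_extChartAt_source v), hYζ]
  have hZ' := connector_of_mem_horizontal hK hS hvs hZ (congrArg Prod.fst hιv)
    (congrArg Prod.snd hιv)
  -- Here the factor `α` is the one read off by `hZ'` from the connector of the horizontal vector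
  -- `Z`, namely `h(a, ∇_X k)`.
  have hmain := covariantDeriv_vertical hιs hd hi
    (Eventually.of_forall fun x => metricInChart_symm g v.1.proj x) hG hYd hYv hYo hξ'
    (Z := chartDeriv v v Z) (by
      rw [hι, hy, fderiv_inclInChart_chartDeriv hS v]
      exact hZ')
  have hleft : sasakiOn g v
      (oneillT (n := n) (sasakiOn g) (projOn (nullCongruence g K)) E₁ E₂ v) Z =
      sasakiOn g v (leviCivita (sasakiOn g) Y v ξ) Z := by
    rw [oneillT, sasakiOn_horProj_add_vertProj hK hS hZ, hE₁v]
  have hright : g.val v.1.proj v.1.2 (leviCivita g.val K v.1.proj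
      (mfderiv (𝓡 (2 * (n - 1))) (𝓡 n) (projOn (nullCongruence g K)) v Z)) =
      h (ι y).1 (ι y).2 (fderiv ℝ k (ι y).1 (inclDeriv v.1 v Z).1 +
        christoffel h (ι y).1 (inclDeriv v.1 v Z).1 (k (ι y).1)) := by
    rw [inclDeriv_fst hS hvs Z, hx1, hx2]
    refine (metricInChart_apply g.val hvs _ _).symm.trans ?_
    exact congrArg (h (extChartAt (𝓡 n) v.1.proj v.1.proj) (chartDeriv v.1.proj v.1.proj v.1.2))
      (chartDeriv_leviCivita g.val K v.1.proj _)
  rw [hleft, leviCivita_apply _ _ hGi, hYζ, ← hy, ← hfield, hmain, hright, hfield, hy,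
    metricInChart_apply _ (mem_extChartAt_source v)]

end ONeillFormula

/-! ### Smooth structure on a subset from slice charts -/

section Slice

open Filter Topology

variable {d : ℕ} {F : Type*} [NormedAddCommGroup F]
  {X : Type*} [TopologicalSpace X] {S : Set X}

open Classical in
/-- The chart of a subset `S` given by a chart `e` of the ambient space in which `S` is the slice
`{(y, 0)}`. -/
def sliceChart (e : OpenPartialHomeomorph X (Eu d × F))
    (he : ∀ z ∈ e.source, z ∈ S ↔ (e z).2 = 0) (p : S) : OpenPartialHomeomorph S (Eu d) where
  toFun q := (e q.1).1
  invFun y := if h : e.symm (y, 0) ∈ S then ⟨e.symm (y, 0), h⟩ else p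
  source := {q | q.1 ∈ e.source}
  target := {y | (y, 0) ∈ e.target}
  map_source' q hq := by
    have h : ((e q.1).1, (0 : F)) = e q.1 := Prod.ext rfl ((he _ hq).1 q.2).symm
    rw [Set.mem_ofPred_eq, h]
    exact e.map_source hq
  map_target' y hy := by
    have h : e.symm (y, 0) ∈ S := (he _ (e.map_target hy)).2 (by rw [e.right_inv hy])
    rw [dif_pos h]
    exact e.map_target hy
  left_inv' q hq := by
    have h : ((e q.1).1, (0 : F)) = e q.1 := Prod.ext rfl ((he _ hq).1 q.2).symm
    have h2 : e.symm ((e q.1).1, (0 : F)) = q.1 := by rw [h, e.left_inv hq]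
    rw [dif_pos (by rw [h2]; exact q.2)]
    exact Subtype.ext h2
  right_inv' y hy := by
    have h : e.symm (y, 0) ∈ S := (he _ (e.map_target hy)).2 (by rw [e.right_inv hy])
    rw [dif_pos h, e.right_inv hy]
  open_source := e.open_source.preimage continuous_subtype_val
  open_target := e.open_target.preimage (by fun_prop)
  continuousOn_toFun := continuous_fst.comp_continuousOn
    (e.continuousOn.comp continuous_subtype_val.continuousOn fun _ hq => hq)
  continuousOn_invFun := by
    rw [Topology.IsInducing.subtypeVal.continuousOn_iff]
    refine ContinuousOn.congr (f := fun y => e.symm (y, 0)) ?_ fun y hy => ?_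
    · exact e.continuousOn_symm.comp (by fun_prop) fun _ hy => hy
    · have h : e.symm (y, 0) ∈ S := (he _ (e.map_target hy)).2 (by rw [e.right_inv hy])
      rw [Function.comp_apply, dif_pos h]

theorem coe_sliceChart_symm {e : OpenPartialHomeomorph X (Eu d × F)}
    (he : ∀ z ∈ e.source, z ∈ S ↔ (e z).2 = 0) (p : S) {y : Eu d} (hy : (y, 0) ∈ e.target) :
    ((sliceChart e he p).symm y : X) = e.symm (y, 0) := by
  have h : e.symm (y, 0) ∈ S := (he _ (e.map_target hy)).2 (by rw [e.right_inv hy])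
  have h2 : (sliceChart e he p).symm y = ⟨e.symm (y, 0), h⟩ := dif_pos h
  rw [h2]

/-- The charts given by a family of slice charts covering `S`. -/
abbrev sliceChartedSpace (e : S → OpenPartialHomeomorph X (Eu d × F))
    (he : ∀ p, ∀ z ∈ (e p).source, z ∈ S ↔ (e p z).2 = 0) (hp : ∀ p : S, p.1 ∈ (e p).source) :
    ChartedSpace (Eu d) S where
  atlas := Set.range fun p => sliceChart (e p) (he p) p
  chartAt p := sliceChart (e p) (he p) p
  mem_chart_source := hp
  chart_mem_atlas p := ⟨p, rfl⟩

variable [NormedSpace ℝ F] {E H : Type*} [NormedAddCommGroup E] [NormedSpace ℝ E] [TopologicalSpace H]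
  {I : ModelWithCorners ℝ E H} [ChartedSpace H X]

theorem isManifold_sliceChartedSpace
  {e : S → OpenPartialHomeomorph X (Eu d × F)}
    (he : ∀ p, ∀ z ∈ (e p).source, z ∈ S ↔ (e p z).2 = 0) (hp : ∀ p : S, p.1 ∈ (e p).source)
    (hs : ∀ p, ∀ z ∈ (e p).source, ContMDiffAt I 𝓘(ℝ, Eu d × F) ∞ (e p) z)
    (hss : ∀ p, ∀ z ∈ (e p).target, ContMDiffAt 𝓘(ℝ, Eu d × F) I ∞ (e p).symm z) :
    letI := sliceChartedSpace e he hp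
    IsManifold (𝓡 d) ∞ S := by
  let _ := sliceChartedSpace e he hp
  refine isManifold_of_contDiffOn (𝓡 d) ∞ S ?_
  rintro _ _ ⟨p, rfl⟩ ⟨q, rfl⟩ y ⟨⟨hy1, hy2⟩, -⟩
  refine ContDiffAt.contDiffWithinAt ?_
  change (y, (0 : F)) ∈ (e p).target at hy1
  change (((sliceChart (e p) (he p) p).symm y : S) : X) ∈ (e q).source at hy2
  rw [coe_sliceChart_symm (he p) p hy1] at hy2
  have h0 : ContMDiffAt 𝓘(ℝ, Eu d) 𝓘(ℝ, Eu d × F) ∞ (fun z : Eu d => (z, (0 : F))) y :=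
    (contDiffAt_id.prodMk contDiffAt_const).contMDiffAt
  have h1 := ((hs q _ hy2).comp y ((hss p _ hy1).comp y h0)).contDiffAt
  refine (contDiffAt_fst.comp y h1).congr_of_eventuallyEq ?_
  have hopen : IsOpen {y : Eu d | (y, (0 : F)) ∈ (e p).target} :=
    (e p).open_target.preimage (by fun_prop)
  filter_upwards [hopen.mem_nhds hy1] with z hz
  have h2 := coe_sliceChart_symm (he p) p hz
  exact congrArg (fun w => (e q w).1) h2

theorem isEmbedded_sliceChartedSpace
  {e : S → OpenPartialHomeomorph X (Eu d × F)}
    (he : ∀ p, ∀ z ∈ (e p).source, z ∈ S ↔ (e p z).2 = 0) (hp : ∀ p : S, p.1 ∈ (e p).source)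
    (hs : ∀ p, ∀ z ∈ (e p).source, ContMDiffAt I 𝓘(ℝ, Eu d × F) ∞ (e p) z)
    (hss : ∀ p, ∀ z ∈ (e p).target, ContMDiffAt 𝓘(ℝ, Eu d × F) I ∞ (e p).symm z) :
    letI := sliceChartedSpace e he hp
    ContMDiff (𝓡 d) I ∞ (Subtype.val : S → X) ∧
      ∀ p : S, Function.Injective (mfderiv (𝓡 d) I (Subtype.val : S → X) p) := by
  let _ := sliceChartedSpace e he hp
  have hman : IsManifold (𝓡 d) ∞ S := isManifold_sliceChartedSpace he hp hs hss
  have hman1 : IsManifold (𝓡 d) 1 S := isManifold_one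
  have hval : ∀ p, ContMDiffAt (𝓡 d) I ∞ (Subtype.val : S → X) p := by
    intro p
    have h1 : ContMDiffAt (𝓡 d) 𝓘(ℝ, Eu d) ∞ (fun q : S => (e p q.1).1) p :=
      contMDiffAt_chart (mem_extChartAt_source p)
    have h0 : ContMDiffAt 𝓘(ℝ, Eu d) 𝓘(ℝ, Eu d × F) ∞ (fun z : Eu d => (z, (0 : F)))
        (e p p.1).1 := (contDiffAt_id.prodMk contDiffAt_const).contMDiffAt
    have hq : ∀ q : S, q.1 ∈ (e p).source → ((e p q.1).1, (0 : F)) = e p q.1 := fun q hq =>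
      Prod.ext rfl ((he p _ hq).1 q.2).symm
    have h2 : ContMDiffAt 𝓘(ℝ, Eu d × F) I ∞ (e p).symm ((e p p.1).1, (0 : F)) := by
      rw [hq p (hp p)]
      exact hss p _ ((e p).map_source (hp p))
    refine (h2.comp p (h0.comp p h1)).congr_of_eventuallyEq ?_
    have hopen : IsOpen {q : S | q.1 ∈ (e p).source} :=
      (e p).open_source.preimage continuous_subtype_val
    filter_upwards [hopen.mem_nhds (hp p)] with q hqs
    change q.1 = (e p).symm ((e p q.1).1, (0 : F))
    rw [hq q hqs, (e p).left_inv hqs]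
  refine ⟨hval, fun p => ?_⟩
  have h1 : HasMFDerivAt (𝓡 d) 𝓘(ℝ, Eu d × F) (e p ∘ Subtype.val) p _ :=
    ((hs p _ (hp p)).mdifferentiableAt (by simp)).hasMFDerivAt.comp p
      ((hval p).mdifferentiableAt (by simp)).hasMFDerivAt
  -- The first component of `e p` along `S` is the chart of `S` at `p`, whose differential is
  -- invertible and factors through that of the inclusion.
  have h2 := ((ContinuousLinearMap.fst ℝ (Eu d) F).hasMFDerivAt.comp p h1).mfderiv
  have hinj := (isInvertible_chartDeriv (m := d) (mem_extChartAt_source (I := 𝓡 d) p)).injective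
  intro u w huw
  refine hinj ?_
  refine (DFunLike.congr_fun h2 u).trans (Eq.trans ?_ (DFunLike.congr_fun h2 w).symm)
  exact congrArg (fun z => (mfderiv I 𝓘(ℝ, Eu d × F) (e p) p.1 z).1) huw

end Slice

/-! ### Straightening a submersion by the inverse function theorem -/

section Straightening

open Filter Topology

/-- A right inverse `s` of `A` gives the projection `x ↦ x - s (A x)` onto the kernel, which
rank-nullity identifies with `Eu d`; together with `A` it is an isomorphism. -/
theorem exists_equiv_prod {d : ℕ} {E F : Type*} [NormedAddCommGroup E] [NormedSpace ℝ E]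
    [FiniteDimensional ℝ E] [NormedAddCommGroup F] [NormedSpace ℝ F] [FiniteDimensional ℝ F]
    (A : E →L[ℝ] F) (hA : Function.Surjective A)
    (hd : Module.finrank ℝ E = d + Module.finrank ℝ F) :
    ∃ L : E ≃L[ℝ] Eu d × F, ∀ x, (L x).2 = A x := by
  obtain ⟨s, hs⟩ := (A : E →ₗ[ℝ] F).exists_rightInverse_of_surjective (LinearMap.range_eq_top.2 hA)
  have hs' : ∀ y, A (s y) = y := fun y => DFunLike.congr_fun hs y
  have hr := (A : E →ₗ[ℝ] F).finrank_range_add_finrank_ker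
  rw [LinearMap.range_eq_top.2 hA, finrank_top] at hr
  let φ : LinearMap.ker (A : E →ₗ[ℝ] F) ≃ₗ[ℝ] Eu d := LinearEquiv.ofFinrankEq _ _ (by
    rw [finrank_euclideanSpace_fin]; omega)
  let P : E →ₗ[ℝ] LinearMap.ker (A : E →ₗ[ℝ] F) :=
    (LinearMap.id - s.comp (A : E →ₗ[ℝ] F)).codRestrict _ fun x => by
      simp [hs']
  let L : E →ₗ[ℝ] Eu d × F := (φ.toLinearMap.comp P).prod (A : E →ₗ[ℝ] F)
  have hinj : Function.Injective L := by
    rw [injective_iff_map_eq_zero]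
    intro x hx
    have h1 : φ (P x) = 0 := congrArg Prod.fst hx
    have h2 : A x = 0 := congrArg Prod.snd hx
    have h3 : x - s (A x) = 0 := congrArg Subtype.val ((map_eq_zero_iff φ φ.injective).1 h1)
    rwa [h2, map_zero, sub_zero] at h3
  refine ⟨(LinearEquiv.ofInjectiveOfFinrankEq L hinj (by
    rw [Module.finrank_prod, finrank_euclideanSpace_fin, hd])).toContinuousLinearEquiv,
    fun x => rfl⟩

/-- A submersion becomes a projection in suitable coordinates. -/
theorem exists_straightening {d : ℕ} {E F : Type*} [NormedAddCommGroup E] [NormedSpace ℝ E]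
    [FiniteDimensional ℝ E] [NormedAddCommGroup F] [NormedSpace ℝ F] [FiniteDimensional ℝ F]
    {f : E → F} {U : Set E} (hU : IsOpen U) (hf : ContDiffOn ℝ ∞ f U) {x : E} (hx : x ∈ U)
    (hA : Function.Surjective (fderiv ℝ f x))
    (hd : Module.finrank ℝ E = d + Module.finrank ℝ F) (c : F) :
    ∃ Φ : OpenPartialHomeomorph E (Eu d × F), x ∈ Φ.source ∧ Φ.source ⊆ U ∧
      (∀ z ∈ Φ.source, ContDiffAt ℝ ∞ Φ z) ∧ (∀ z ∈ Φ.target, ContDiffAt ℝ ∞ Φ.symm z) ∧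
      ∀ z, (Φ z).2 = f z - c := by
  have hcE : CompleteSpace E := FiniteDimensional.complete ℝ E
  obtain ⟨L, hL⟩ := exists_equiv_prod (fderiv ℝ f x) hA hd
  set G : E → Eu d × F := fun z => ((L z).1, f z - c) with hG
  have hGU : ContDiffOn ℝ ∞ G U :=
    (contDiff_fst.comp L.contDiff).contDiffOn.prodMk (hf.sub contDiffOn_const)
  have hGat : ∀ z ∈ U, ContDiffAt ℝ ∞ G z := fun z hz => hGU.contDiffAt (hU.mem_nhds hz)
  have hGx : HasFDerivAt G (L : E →L[ℝ] Eu d × F) x := by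
    have h1 : HasFDerivAt (fun z => (L z).1)
        ((ContinuousLinearMap.fst ℝ (Eu d) F).comp (L : E →L[ℝ] Eu d × F)) x :=
      hasFDerivAt_fst.comp x L.hasFDerivAt
    have h2 : HasFDerivAt (fun z => f z - c) (fderiv ℝ f x) x :=
      (((hf.contDiffAt (hU.mem_nhds hx)).differentiableAt (by simp)).hasFDerivAt).sub_const c
    convert h1.prodMk h2 using 1
    ext z
    · rfl
    · exact hL z
  have hGfd : ContinuousOn (fderiv ℝ G) U := hGU.continuousOn_fderiv_of_isOpen hU (by simp)
  -- Shrinking to the open set where the differential of `G` is invertible makes the local inverse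
  -- smooth on the whole target, not only at the image of `x`.
  set O : Set E := U ∩ fderiv ℝ G ⁻¹' Set.range ((↑) : (E ≃L[ℝ] Eu d × F) → E →L[ℝ] Eu d × F)
  have hO : IsOpen O := hGfd.isOpen_inter_preimage hU ContinuousLinearEquiv.isOpen
  set Ψ := (hGat x hx).toOpenPartialHomeomorph G hGx (by simp)
  have hΨ : ∀ z, Ψ z = G z := fun z => rfl
  refine ⟨Ψ.restrOpen O hO, ⟨?_, hx, L, hGx.fderiv.symm⟩, fun z hz => hz.2.1, fun z hz => ?_,
    fun z hz => ?_, fun z => rfl⟩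
  · exact (hGat x hx).mem_toOpenPartialHomeomorph_source hGx (by simp)
  · exact hGat z hz.2.1
  · have hzs := (Ψ.restrOpen O hO).map_target hz
    obtain ⟨L', hL'⟩ := hzs.2.2
    refine (Ψ.restrOpen O hO).contDiffAt_symm hz (f₀' := L') ?_ (hGat _ hzs.2.1)
    rw [hL']
    exact ((hGat _ hzs.2.1).differentiableAt (by simp)).hasFDerivAt

end Straightening

/-! ### The null congruence is an embedded submanifold -/

section Existence

open Filter Topology

variable {n : ℕ} {M : Type*} [TopologicalSpace M] [ChartedSpace (Eu n) M] [IsManifold (𝓡 n) ∞ M]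
  {g : LorentzianMetric n M} {K : Π p : M, TangentSpace (𝓡 n) p}

/-- The chart of the tangent bundle at `v`, with values in `ℝⁿ × ℝⁿ`. -/
def tangentChart (v : TangentBundle (𝓡 n) M) :
    OpenPartialHomeomorph (TangentBundle (𝓡 n) M) (Eu n × Eu n) where
  toPartialEquiv := extChartAt (𝓡 n).tangent v
  open_source := isOpen_extChartAt_source v
  open_target := isOpen_extChartAt_target v
  continuousOn_toFun := continuousOn_extChartAt v
  continuousOn_invFun := continuousOn_extChartAt_symm v

/-- The chart of `TM` followed by a straightening of the defining function shifted by its value `(0,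
-1)`, so that the congruence becomes the zero slice. The dimension count `2n = 2(n - 1) + 2`
requires `1 ≤ n`. -/
theorem exists_sliceChart (hn : 1 ≤ n)
    (hK : ContMDiff (𝓡 n) (𝓡 n).tangent ∞ (fun p => (⟨p, K p⟩ : TangentBundle (𝓡 n) M)))
    (v : nullCongruence g K) :
    ∃ e : OpenPartialHomeomorph (TangentBundle (𝓡 n) M) (Eu (2 * (n - 1)) × (ℝ × ℝ)),
      (∀ z ∈ e.source, z ∈ nullCongruence g K ↔ (e z).2 = 0) ∧ v.1 ∈ e.source ∧
      (∀ z ∈ e.source, ContMDiffAt (𝓡 n).tangent 𝓘(ℝ, Eu (2 * (n - 1)) × (ℝ × ℝ)) ∞ e z) ∧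
      ∀ z ∈ e.target, ContMDiffAt 𝓘(ℝ, Eu (2 * (n - 1)) × (ℝ × ℝ)) (𝓡 n).tangent ∞ e.symm z := by
  set F := congruenceFun (metricInChart g.val v.1.proj) (fieldInChart K v.1.proj) with hF
  set x := extChartAt (𝓡 n).tangent v.1 v.1 with hx
  have hman : IsManifold (𝓡 n) (∞ + 1) M := by simpa
  have hvs : v.1.proj ∈ (extChartAt (𝓡 n) v.1.proj).source := mem_extChartAt_source _
  have htarget : ∀ z ∈ (tangentChart v.1).target, z.1 ∈ (extChartAt (𝓡 n) v.1.proj).target := by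
    intro z hz
    change z ∈ (extChartAt (𝓡 n).tangent v.1).target at hz
    rw [FiberBundle.extChartAt_target] at hz
    exact hz.1.1
  have hx1 : x ∈ (tangentChart v.1).target := mem_extChartAt_target v.1
  have hFat : ∀ z ∈ (tangentChart v.1).target, ContDiffAt ℝ ∞ F z := fun z hz =>
    contDiffAt_congruenceFun (contDiffAt_metricInChart g (htarget z hz))
      (contDiffAt_fieldInChart (htarget z hz) hK.contMDiffAt)
  have hFx : F x = (0, -1) := (mem_nullCongruence_iff hvs).1 v.2
  have hsurj := surjective_fderiv_congruenceFun (contDiffAt_metricInChart g (htarget x hx1))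
    (contDiffAt_fieldInChart (htarget x hx1) hK.contMDiffAt)
    (isInvertible_metricInChart g (htarget x hx1))
    (Eventually.of_forall fun y => metricInChart_symm g v.1.proj y) hFx
  obtain ⟨Φ, hΦx, hΦs, hΦ1, hΦ2, hΦF⟩ := exists_straightening (d := 2 * (n - 1))
    (tangentChart v.1).open_target (fun z hz => (hFat z hz).contDiffWithinAt) hx1 hsurj (by
      simp only [Module.finrank_prod, finrank_euclideanSpace_fin, Module.finrank_self]
      omega) (0, -1)
  have hsrc : ∀ z ∈ (tangentChart v.1).source, z.proj ∈ (extChartAt (𝓡 n) v.1.proj).source := by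
    intro z hz
    change z ∈ (extChartAt (𝓡 n).tangent v.1).source at hz
    rwa [extChartAt_tangent_source] at hz
  refine ⟨(tangentChart v.1).trans Φ, fun z hz => ?_, ⟨mem_extChartAt_source v.1, hΦx⟩,
    fun z hz => ?_, fun z hz => ?_⟩
  · rw [mem_nullCongruence_iff (hsrc z hz.1), ← sub_eq_zero]
    exact Iff.of_eq (congrArg (· = 0) (hΦF _).symm)
  · have h1 : ContMDiffAt (𝓡 n).tangent 𝓘(ℝ, Eu n × Eu n) ∞ (tangentChart v.1) z :=
      contMDiffAt_chart_tangent (hsrc z hz.1)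
    have h2 : ContMDiffAt 𝓘(ℝ, Eu n × Eu n) 𝓘(ℝ, Eu (2 * (n - 1)) × (ℝ × ℝ)) ∞ Φ
        (tangentChart v.1 z) := (hΦ1 _ hz.2).contMDiffAt
    exact h2.comp z h1
  · have h1 : ContMDiffAt 𝓘(ℝ, Eu n × Eu n) (𝓡 n).tangent ∞ (extChartAt (𝓡 n).tangent v.1).symm
        (Φ.symm z) :=
      (contMDiffOn_extChartAt_symm v.1).contMDiffAt ((isOpen_extChartAt_target v.1).mem_nhds hz.2)
    exact h1.comp z (hΦ2 z hz.1).contMDiffAt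

theorem exists_chartedSpace_nullCongruence (hn : 1 ≤ n)
    (hK : ContMDiff (𝓡 n) (𝓡 n).tangent ∞ (fun p => (⟨p, K p⟩ : TangentBundle (𝓡 n) M))) :
    ∃ _ : ChartedSpace (Eu (2 * (n - 1))) (nullCongruence g K),
      IsManifold (𝓡 (2 * (n - 1))) ∞ (nullCongruence g K) ∧
      IsEmbeddedSubmanifold (2 * (n - 1)) (nullCongruence g K) := by
  choose e he hp hs hss using exists_sliceChart (g := g) hn hK
  exact ⟨sliceChartedSpace e he hp, isManifold_sliceChartedSpace he hp hs hss,
    isEmbedded_sliceChartedSpace he hp hs hss⟩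

end Existence

end NullCongruence

end

theorem mainTheorem4 {n : ℕ} (hn : 3 ≤ n)
    {M : Type*} [TopologicalSpace M] [T2Space M] [SecondCountableTopology M] [ConnectedSpace M]
    [ChartedSpace (Eu n) M] [IsManifold (𝓡 n) ∞ M]
    (g : LorentzianMetric n M)
    (K : Π p : M, TangentSpace (𝓡 n) p)
    (hK : ContMDiff (𝓡 n) (𝓡 n).tangent ∞ (fun p => (⟨p, K p⟩ : TangentBundle (𝓡 n) M)))
    (hKt : ∀ p : M, g.val p (K p) (K p) < 0) :
    -- `C_K M` is an embedded submanifold of `TM`, of dimension `2 (n - 1)`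
    (∃ _ : ChartedSpace (Eu (2 * (n - 1))) (nullCongruence g K),
      IsManifold (𝓡 (2 * (n - 1))) ∞ (nullCongruence g K) ∧
      IsEmbeddedSubmanifold (2 * (n - 1)) (nullCongruence g K)) ∧
    -- and, for this smooth structure, the O'Neill tensor `T` of `π|_{C_K M}` is as claimed
    ∀ [ChartedSpace (Eu (2 * (n - 1))) (nullCongruence g K)]
      [IsManifold (𝓡 (2 * (n - 1))) ∞ (nullCongruence g K)],
      IsEmbeddedSubmanifold (2 * (n - 1)) (nullCongruence g K) →
      ∀ (v : nullCongruence g K) (ξ ζ Z : TangentSpace (𝓡 (2 * (n - 1))) v),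
        ξ ∈ vertical (n := n) (projOn (nullCongruence g K)) v →
        ζ ∈ vertical (n := n) (projOn (nullCongruence g K)) v →
        Z ∈ horizontal (n := n) (sasakiOn g) (projOn (nullCongruence g K)) v →
        -- `T_ξ ζ` is computed with any vector fields `E₁`, `E₂` extending `ξ`, `ζ`
        ∀ E₁ E₂ : Π w : nullCongruence g K, TangentSpace (𝓡 (2 * (n - 1))) w,
          IsSmoothExtension v ξ E₁ → IsSmoothExtension v ζ E₂ →
          sasakiOn g v
              (oneillT (n := n) (sasakiOn g) (projOn (nullCongruence g K)) E₁ E₂ v) Z =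
            - g.val v.1.proj v.1.2
                (leviCivita g.val K v.1.proj
                  (mfderiv (𝓡 (2 * (n - 1))) (𝓡 n) (projOn (nullCongruence g K)) v Z)) *
              sasakiOn g v ξ ζ := by
  exact ⟨exists_chartedSpace_nullCongruence (by omega) hK,
    fun hS v ξ ζ Z hξ hζ hZ E₁ E₂ hE₁ hE₂ => sasakiOn_oneillT hK hS v ξ ζ Z hξ hζ hZ E₁ E₂ hE₁ hE₂⟩
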